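/- Let $\mathsf X$ be a non-compact Polish space with its Borel $\sigma$-algebra. Let $(M_n)_{n\ge1}$ be Markov kernels on $\mathsf X$, let $(G_n)_{n\ge0}$ be measurable, strictly positive, real-valued functions on $\mathsf X$, and put $Q_n(x,dx')=G_{n-1}(x)M_n(x,dx')$ for $n\ge1$, $Q_{p,n}=Q_{p+1}\cdots Q_n$ for $0\le p<n$, and $Q_{n,n}=\mathrm{Id}$. Let $\mu$ be a probability measure on $\mathsf X$. For a kernel $K$, a measure $\eta$ and a function $\varphi$ write $K(\varphi)(x)=\int\varphi(y)\,K(x,dy)$ and $\eta(\varphi)=\int\varphi\,d\eta$. Assume: (H1) $V:\mathsf X\to[1,\infty)$ is measurable and unbounded, $\delta>0$, $\underline d\ge1$, and for each $d\in[\underline d,\infty)$ there is $b_d<\infty$ such that, with $C_d=\{x:V(x)\le d\}$, $$\sup_{n\ge1}Q_n(e^V)(x)\le\exp\big(V(x)(1-\delta)+b_d\mathbb I_{C_d}(x)\big)\quad\text{for all }x\in\mathsf X.$$ (H2) $\mu\in\mathcal P_v$, where $v=e^V$ and $\mathcal P_v$ is the set of probability measures $\eta$ with $\eta(v)<\infty$.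 (H3) For each $d\in[\underline d,\infty)$: $Q_n(x,C_d)>0$ for all $x\in\mathsf X$ and $n\ge1$, and there are $\epsilon_d^->0$ and $\nu_d\in\mathcal P_v$ such that $\inf_{n\ge1}Q_n(x,C_d\cap A)\ge\epsilon_d^-\nu_d(C_d\cap A)$ for all $x\in C_d$ and all measurable $A$, and $\nu_d(C_r)>0$ for all $r\in[\underline d,d]$. (H4) For each $d\in[\underline d,\infty)$ there is $\epsilon_d^+\in[\epsilon_d^-,\infty)$ such that $\sup_{n\ge1}Q_n(x,C_d\cap A)\le\epsilon_d^+\nu_d(C_d\cap A)$ for all $x\in C_d$ and all measurable $A$. Let $\gamma_n=\mu Q_{0,n}$, $\eta_n=\gamma_n/\gamma_n(1)$, $\lambda_n=\eta_n(G_n)$ and $h_{p,n}(x)=Q_{p,n}(1)(x)/\prod_{q=p}^{n-1}\lambda_q$ for $0\le p\le n$. Let $\|\varphi\|_v=\sup_x|\varphi(x)|/v(x)$, and let $\mathcal L_v$ be the set of measurable $\varphi:\mathsf X\to\mathbb R$ with $\|\varphi\|_v<\infty$. Then there exist $\rho\in[0,1)$ and $c_\mu<\infty$, depending only on $\mu$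 and on the data $V,\delta,\underline d,(b_d),(\epsilon_d^-),(\nu_d),(\epsilon_d^+)$ of the assumptions (and not otherwise on the sequences $(M_n)$ and $(G_n)$), such that the following holds. All $\lambda_n$ are strictly positive, and for every $\varphi\in\mathcal L_v$, $n\ge1$, $0\le p<n$ and $x\in\mathsf X$, $\varphi$ is integrable with respect to $Q_{p,n}(x,\cdot)$ and $\eta_n$, and $$\left|\frac{Q_{p,n}(\varphi)(x)}{\prod_{q=p}^{n-1}\lambda_q}-h_{p,n}(x)\,\eta_n(\varphi)\right|\le\rho^{\,n-p}\,\|\varphi\|_v\,c_\mu\,v(x)\,\mu(v).$$ -/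

import Mathlib

open MeasureTheory ProbabilityTheory
open scoped ENNReal

noncomputable section

/-- A Feynman-Kac model on `X`: Markov kernels `M n` (only the indices `n ≥ 1` are used) and
measurable, strictly positive, real-valued potential functions `G n`, `n ≥ 0`. -/
structure FKModel (X : Type*) [MeasurableSpace X] where
  M : ℕ → Kernel X X
  markov : ∀ n, IsMarkovKernel (M n)
  G : ℕ → X → ℝ
  measurable_G : ∀ n, Measurable (G n)
  G_pos : ∀ n x, 0 < G n x

namespace FKModel

variable {X : Type*} [MeasurableSpace X]

/-- The kernel `Q_n(x, dx') = G_{n-1}(x) M_n(x, dx')` for `n ≥ 1`; there is no `Q_0` and the value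
at `0` is a placeholder that is never used. -/
def Q (F : FKModel X) : ℕ → Kernel X X
  | 0 => 0
  | n + 1 =>
    { toFun := fun x => ENNReal.ofReal (F.G n x) • F.M (n + 1) x
      measurable' := by
        refine Measure.measurable_of_measurable_coe _ fun s hs => ?_
        simp only [Measure.smul_apply, smul_eq_mul]
        exact ((F.measurable_G n).ennreal_ofReal).mul ((F.M (n + 1)).measurable_coe hs) }

/-- The semigroup `Q_{p,n} = Q_{p+1} ⋯ Q_n` for `p < n`, with `Q_{n,n} = Id`
(and `Q_{p,n} = Id` for `p > n`). `κ' ∘ₖ κ` is the composition that moves by `κ` first. -/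
def semigroup (F : FKModel X) (p : ℕ) : ℕ → Kernel X X
  | 0 => Kernel.id
  | n + 1 => if p ≤ n then F.Q (n + 1) ∘ₖ F.semigroup p n else Kernel.id

/-- `Q_{p,n}(φ)(x) = ∫ φ(y) Q_{p,n}(x, dy)`. -/
def semigroupOp (F : FKModel X) (p n : ℕ) (φ : X → ℝ) (x : X) : ℝ :=
  ∫ y, φ y ∂(F.semigroup p n x)

/-- The unnormalised measures `γ_n = μ Q_{0,n}`. -/
def gamma (F : FKModel X) (μ : Measure X) (n : ℕ) : Measure X :=
  μ.bind (F.semigroup 0 n)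

/-- The normalised measures `η_n = γ_n / γ_n(1)`. -/
def eta (F : FKModel X) (μ : Measure X) (n : ℕ) : Measure X :=
  (F.gamma μ n Set.univ)⁻¹ • F.gamma μ n

/-- `λ_n = η_n(G_n)`. -/
def lam (F : FKModel X) (μ : Measure X) (n : ℕ) : ℝ :=
  ∫ x, F.G n x ∂(F.eta μ n)

/-- `h_{p,n}(x) = Q_{p,n}(1)(x) / ∏_{q=p}^{n-1} λ_q`; it equals `1` when `p = n`. -/
def h (F : FKModel X) (μ : Measure X) (p n : ℕ) (x : X) : ℝ :=
  F.semigroupOp p n (fun _ => 1) x / ∏ q ∈ Finset.Ico p n, F.lam μ q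

end FKModel

/-- The weighting function `v = e^V`. -/
def expWeight {X : Type*} (V : X → ℝ) (x : X) : ℝ := Real.exp (V x)

/-- The sublevel set `C_d = {x | V x ≤ d}`. -/
def sublevel {X : Type*} (V : X → ℝ) (d : ℝ) : Set X := {x | V x ≤ d}

/-- The weighted norm `‖φ‖_v = sup_x |φ x| / v x`, for `φ ∈ L_v`. -/
def vNorm {X : Type*} (v φ : X → ℝ) : ℝ := ⨆ x, |φ x| / v x

/-- `φ ∈ L_v`: `φ` is measurable and `sup_x |φ x| / v x < ∞`. -/
def MemLv {X : Type*} [MeasurableSpace X] (v φ : X → ℝ) : Prop :=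
  Measurable φ ∧ BddAbove (Set.range fun x => |φ x| / v x)

/-- `η ∈ P_v`: `η` is a probability measure with `η(v) < ∞`. -/
def MemPv {X : Type*} [MeasurableSpace X] (v : X → ℝ) (η : Measure X) : Prop :=
  IsProbabilityMeasure η ∧ ∫⁻ x, ENNReal.ofReal (v x) ∂η < ∞

/-- The multiplicative drift condition, with drift function `V` and constants `δ`, `d₀` and
`b d` for `d ≥ d₀`. -/
structure DriftCondition {X : Type*} [MeasurableSpace X] (F : FKModel X)
    (V : X → ℝ) (δ d₀ : ℝ) (b : ℝ → ℝ) : Prop where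
  measurable_V : Measurable V
  one_le_V : ∀ x, 1 ≤ V x
  unbounded_V : ¬ BddAbove (Set.range V)
  delta_pos : 0 < δ
  one_le_d₀ : 1 ≤ d₀
  drift : ∀ d, d₀ ≤ d → ∀ n, 1 ≤ n → ∀ x,
    ∫⁻ y, ENNReal.ofReal (expWeight V y) ∂(F.Q n x) ≤
      ENNReal.ofReal (Real.exp
        (V x * (1 - δ) + b d * (sublevel V d).indicator (fun _ => (1 : ℝ)) x))

/-- Accessibility of the sublevel sets and the time-uniform local minorization. -/
structure MinorizationCondition {X : Type*} [MeasurableSpace X] (F : FKModel X)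
    (V : X → ℝ) (d₀ : ℝ) (εm : ℝ → ℝ) (ν : ℝ → Measure X) : Prop where
  accessible : ∀ d, d₀ ≤ d → ∀ n, 1 ≤ n → ∀ x, 0 < F.Q n x (sublevel V d)
  eps_pos : ∀ d, d₀ ≤ d → 0 < εm d
  nu_mem : ∀ d, d₀ ≤ d → MemPv (expWeight V) (ν d)
  minor : ∀ d, d₀ ≤ d → ∀ n, 1 ≤ n → ∀ x ∈ sublevel V d, ∀ A, MeasurableSet A →
    ENNReal.ofReal (εm d) * ν d (sublevel V d ∩ A) ≤ F.Q n x (sublevel V d ∩ A)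
  nu_pos : ∀ d, d₀ ≤ d → ∀ r ∈ Set.Icc d₀ d, 0 < ν d (sublevel V r)

/-- The time-uniform local majorization. -/
structure MajorizationCondition {X : Type*} [MeasurableSpace X] (F : FKModel X)
    (V : X → ℝ) (d₀ : ℝ) (εm : ℝ → ℝ) (ν : ℝ → Measure X) (εp : ℝ → ℝ) : Prop where
  eps_le : ∀ d, d₀ ≤ d → εm d ≤ εp d
  major : ∀ d, d₀ ≤ d → ∀ n, 1 ≤ n → ∀ x ∈ sublevel V d, ∀ A, MeasurableSet A →
    F.Q n x (sublevel V d ∩ A) ≤ ENNReal.ofReal (εp d) * ν d (sublevel V d ∩ A)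

end

/-!
The drift condition confines the mass of `γ_n` to a sublevel set `C_r`, and the minorization keeps
a fixed proportion of it there, so that `γ_n(v)` is bounded by a multiple of `γ_n(C_r)`, uniformly
in `n`. Backward induction on `p` compares `Q_{p,n}(1)` with its own lower bound on `C_r`: the drift
handles the starting points far out, the two-sided local bounds those nearby. Dividing by the
`λ_q`, one finds that `h_{p,n}` is at most `D v` and at least `1 / D` on `C_r`, with `D` independent
of `p`, `n` and the model.

Since `Q_{p+1}(h_{p+1,n}) = λ_p h_{p,n}`, each `Q_{p+1}` is, up to the change of function by
`h_{p,n}`, a Markov kernel satisfying a drift and a minorization condition, and contracts the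
oscillation modulo multiples of `h_{p,n}`, weighted by `h_{p,n} + β v`, by a factor `ρ < 1`.
Iterating gives a constant `c` with `Q_{p,n}(φ) / ∏ λ_q` within `O(ρ^{n-p} (h_{p,n} + β v))` of
`c h_{p,n}`, and integrating against `η_p`, where `η_p(h_{p,n}) = 1`, shows that `c` may be replaced
by `η_n(φ)`.
-/

section Integration

variable {X Y : Type*} [MeasurableSpace X] [MeasurableSpace Y]

lemma integral_comp_measure {μ : Measure X} {κ : Kernel X Y} {f : Y → ℝ}
    (hf : Integrable f (κ ∘ₘ μ)) : ∫ y, f y ∂(κ ∘ₘ μ) = ∫ x, ∫ y, f y ∂(κ x) ∂μ := by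
  rw [Measure.comp_eq_comp_const_apply] at hf ⊢
  rw [Kernel.integral_comp hf, Kernel.const_apply]

lemma integrable_integral_of_comp_measure {μ : Measure X} {κ : Kernel X Y} {f : Y → ℝ}
    (hf : Integrable f (κ ∘ₘ μ)) : Integrable (fun x => ∫ y, f y ∂(κ x)) μ := by
  rw [Measure.comp_eq_comp_const_apply] at hf
  simpa only [Kernel.const_apply] using hf.integral_comp

lemma measureReal_mul_le_integral {η : Measure X} [IsFiniteMeasure η] {s : Set X}
    (hs : MeasurableSet s) {g : X → ℝ} (hg : ∀ x, 0 ≤ g x) (hgi : Integrable g η) {c : ℝ}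
    (hc : ∀ x ∈ s, c ≤ g x) : η.real s * c ≤ ∫ x, g x ∂η := by
  rw [mul_comm]
  exact (setIntegral_ge_of_const_le_real hs (measure_ne_top _ _) hc hgi.integrableOn).trans
    (setIntegral_le_integral hgi (.of_forall hg))

lemma measureReal_mul_le_comp_measure {μ : Measure X} {κ : Kernel X Y} [IsFiniteMeasure (κ ∘ₘ μ)]
    {m : Measure Y} {s : Set X} (hm : ∀ x ∈ s, m ≤ κ x) {t : Set Y} (ht : MeasurableSet t) :
    m.real t * μ.real s ≤ (κ ∘ₘ μ).real t := by
  rw [measureReal_def, measureReal_def, ← ENNReal.toReal_mul]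
  refine ENNReal.toReal_mono (measure_ne_top _ _) ?_
  calc m t * μ s = ∫⁻ _ in s, m t ∂μ := (setLIntegral_const s _).symm
    _ ≤ ∫⁻ x in s, κ x t ∂μ := setLIntegral_mono (κ.measurable_coe ht) fun x hx => hm x hx t
    _ ≤ ∫⁻ x, κ x t ∂μ := setLIntegral_le_lintegral _ _
    _ = (κ ∘ₘ μ) t := (Measure.bind_apply ht κ.aemeasurable).symm

end Integration

namespace FKModel

variable {X : Type*} [MeasurableSpace X] {F : FKModel X} {μ : Measure X} {p n : ℕ}
  {φ : X → ℝ} {x : X}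

lemma Q_succ_apply (F : FKModel X) (n : ℕ) (x : X) :
    F.Q (n + 1) x = ENNReal.ofReal (F.G n x) • F.M (n + 1) x := rfl

lemma measureReal_univ_Q_succ (F : FKModel X) (n : ℕ) (x : X) :
    (F.Q (n + 1) x).real Set.univ = F.G n x := by
  have := F.markov (n + 1)
  simp [Q_succ_apply, measureReal_def, (F.G_pos n x).le]

lemma semigroup_self (F : FKModel X) (n : ℕ) : F.semigroup n n = Kernel.id := by
  cases n <;> simp [semigroup]

lemma semigroup_succ (F : FKModel X) (h : p ≤ n) :
    F.semigroup p (n + 1) = F.Q (n + 1) ∘ₖ F.semigroup p n := by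
  simp [semigroup, h]

lemma semigroup_eq_comp_Q (F : FKModel X) (h : p < n) :
    F.semigroup p n = F.semigroup (p + 1) n ∘ₖ F.Q (p + 1) := by
  induction n, h using Nat.le_induction with
  | base => rw [semigroup_succ F le_rfl, semigroup_self, semigroup_self, Kernel.comp_id,
      Kernel.id_comp]
  | succ n h ih => rw [semigroup_succ F (by lia), semigroup_succ F h, ih, Kernel.comp_assoc]

lemma gamma_zero (F : FKModel X) (μ : Measure X) : F.gamma μ 0 = μ := by
  rw [gamma, semigroup_self, Measure.id_comp]

lemma gamma_succ (F : FKModel X) (μ : Measure X) (n : ℕ) :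
    F.gamma μ (n + 1) = F.Q (n + 1) ∘ₘ F.gamma μ n := by
  rw [gamma, gamma, semigroup_succ F (Nat.zero_le n), Measure.comp_assoc]

lemma gamma_eq_semigroup_comp (F : FKModel X) (μ : Measure X) (h : p ≤ n) :
    F.gamma μ n = F.semigroup p n ∘ₘ F.gamma μ p := by
  induction n, h using Nat.le_induction with
  | base => rw [semigroup_self, Measure.id_comp]
  | succ n h ih => rw [semigroup_succ F h, gamma_succ, ih, Measure.comp_assoc]

lemma measurable_semigroupOp (F : FKModel X) (p n : ℕ) (hφ : Measurable φ) :
    Measurable (F.semigroupOp p n φ) :=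
  (hφ.stronglyMeasurable.integral_kernel (κ := F.semigroup p n)).measurable

lemma semigroupOp_self (F : FKModel X) (n : ℕ) (hφ : Measurable φ) (x : X) :
    F.semigroupOp n n φ x = φ x := by
  rw [semigroupOp, semigroup_self, Kernel.id_apply, integral_dirac' _ _ hφ.stronglyMeasurable]

lemma semigroupOp_eq_integral_Q (h : p < n) (hφ : Integrable φ (F.semigroup p n x)) :
    F.semigroupOp p n φ x = ∫ y, F.semigroupOp (p + 1) n φ y ∂(F.Q (p + 1) x) := by
  rw [semigroup_eq_comp_Q F h] at hφ
  simp only [semigroupOp]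
  rw [semigroup_eq_comp_Q F h, Kernel.integral_comp hφ]

lemma integrable_semigroupOp_gamma (h : p ≤ n) (hφ : Integrable φ (F.gamma μ n)) :
    Integrable (F.semigroupOp p n φ) (F.gamma μ p) :=
  integrable_integral_of_comp_measure (gamma_eq_semigroup_comp F μ h ▸ hφ)

lemma integral_gamma_eq (h : p ≤ n) (hφ : Integrable φ (F.gamma μ n)) :
    ∫ y, φ y ∂(F.gamma μ n) = ∫ y, F.semigroupOp p n φ y ∂(F.gamma μ p) := by
  rw [gamma_eq_semigroup_comp F μ h] at hφ ⊢
  exact integral_comp_measure hφ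

section Normalization

/-- The normalised semigroup `Q_{p,n}(φ) / ∏_{q=p}^{n-1} λ_q`; the function `h_{p,n}` is its value
at the constant `1`. -/
noncomputable def normOp (F : FKModel X) (μ : Measure X) (p n : ℕ) (φ : X → ℝ) (x : X) : ℝ :=
  F.semigroupOp p n φ x / ∏ q ∈ Finset.Ico p n, F.lam μ q

lemma normOp_self (n : ℕ) (hφ : Measurable φ) (x : X) : F.normOp μ n n φ x = φ x := by
  simp [normOp, F.semigroupOp_self n hφ]

lemma measurable_h (F : FKModel X) (μ : Measure X) (p n : ℕ) : Measurable (F.h μ p n) :=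
  (F.measurable_semigroupOp p n measurable_const).div_const _

lemma integrable_normOp_Q (h : p < n) (hφ : Integrable φ (F.semigroup p n x)) :
    Integrable (F.normOp μ (p + 1) n φ) (F.Q (p + 1) x) := by
  rw [semigroup_eq_comp_Q F h, Kernel.comp_apply] at hφ
  exact (integrable_integral_of_comp_measure hφ).div_const _

lemma integral_normOp_Q (h : p < n) (hlam : F.lam μ p ≠ 0)
    (hφ : Integrable φ (F.semigroup p n x)) :
    ∫ y, F.normOp μ (p + 1) n φ y ∂(F.Q (p + 1) x) = F.lam μ p * F.normOp μ p n φ x := by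
  simp only [normOp]
  rw [integral_div, ← semigroupOp_eq_integral_Q h hφ, Finset.prod_eq_prod_Ico_succ_bot h]
  field_simp

lemma integral_h_Q [IsFiniteMeasure (F.semigroup p n x)] (h : p < n) (hlam : F.lam μ p ≠ 0) :
    ∫ y, F.h μ (p + 1) n y ∂(F.Q (p + 1) x) = F.lam μ p * F.h μ p n x :=
  integral_normOp_Q h hlam (integrable_const 1)

lemma integral_eta (F : FKModel X) (μ : Measure X) (n : ℕ) (φ : X → ℝ) :
    ∫ y, φ y ∂(F.eta μ n) = (∫ y, φ y ∂(F.gamma μ n)) / (F.gamma μ n).real Set.univ := by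
  rw [eta, integral_smul_measure, ENNReal.toReal_inv, smul_eq_mul, measureReal_def]
  ring

lemma integrable_eta (hμ : F.gamma μ n ≠ 0) (hφ : Integrable φ (F.gamma μ n)) :
    Integrable φ (F.eta μ n) :=
  hφ.smul_measure (ENNReal.inv_ne_top.2 (by simpa using hμ))

lemma integrable_normOp_eta (hμ : F.gamma μ p ≠ 0) (h : p ≤ n) (hφ : Integrable φ (F.gamma μ n)) :
    Integrable (F.normOp μ p n φ) (F.eta μ p) :=
  integrable_eta hμ ((integrable_semigroupOp_gamma h hφ).div_const _)

variable [∀ n, IsFiniteMeasure (F.gamma μ n)]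

lemma integral_G_gamma (n : ℕ) :
    ∫ x, F.G n x ∂(F.gamma μ n) = (F.gamma μ (n + 1)).real Set.univ :=
  calc ∫ x, F.G n x ∂(F.gamma μ n)
      = ∫ x, ∫ _, (1 : ℝ) ∂(F.Q (n + 1) x) ∂(F.gamma μ n) := by
        simp [measureReal_univ_Q_succ]
    _ = ∫ _, (1 : ℝ) ∂(F.gamma μ (n + 1)) := by
        have := integrable_const (μ := F.gamma μ (n + 1)) (1 : ℝ)
        rw [gamma_succ] at this ⊢
        rw [integral_comp_measure this]
    _ = _ := by simp

lemma lam_eq (n : ℕ) :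
    F.lam μ n = (F.gamma μ (n + 1)).real Set.univ / (F.gamma μ n).real Set.univ := by
  rw [lam, integral_eta, integral_G_gamma]

variable [∀ n, NeZero (F.gamma μ n)]

lemma prod_lam_eq (h : p ≤ n) :
    ∏ q ∈ Finset.Ico p n, F.lam μ q =
      (F.gamma μ n).real Set.univ / (F.gamma μ p).real Set.univ := by
  have hpos : ∀ m, (F.gamma μ m).real Set.univ ≠ 0 := fun m => measureReal_univ_pos.ne'
  induction n, h using Nat.le_induction with
  | base => simp [hpos p]
  | succ n h ih =>
    rw [Finset.prod_Ico_succ_top h, ih, lam_eq]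
    field_simp [hpos n, hpos p]

lemma integral_normOp_eta (h : p ≤ n) (hφ : Integrable φ (F.gamma μ n)) :
    ∫ y, F.normOp μ p n φ y ∂(F.eta μ p) = ∫ y, φ y ∂(F.eta μ n) := by
  have hpos : ∀ m, (F.gamma μ m).real Set.univ ≠ 0 := fun m => measureReal_univ_pos.ne'
  simp only [normOp]
  rw [integral_div, integral_eta, integral_eta, prod_lam_eq h, ← integral_gamma_eq h hφ]
  field_simp [hpos n, hpos p]

lemma integral_h_eta (h : p ≤ n) : ∫ y, F.h μ p n y ∂(F.eta μ p) = 1 := by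
  refine (integral_normOp_eta h (integrable_const 1)).trans ?_
  rw [integral_eta, integral_const, smul_eq_mul, mul_one, div_self measureReal_univ_pos.ne']

end Normalization

end FKModel

section Contraction

lemma exists_abs_sub_mul_le {ι : Type*} {u w a : ι → ℝ} (hw : ∀ i, 0 < w i)
    (h : ∀ i j, w j * u i - w i * u j ≤ w j * a i + w i * a j) :
    ∃ c : ℝ, ∀ i, |u i - c * w i| ≤ a i := by
  rcases isEmpty_or_nonempty ι with hι | hι
  · exact ⟨0, fun i => hι.elim i⟩
  have hle : ∀ i j, (u i - a i) / w i ≤ (u j + a j) / w j := fun i j => by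
    rw [div_le_div_iff₀ (hw i) (hw j)]
    linarith [h i j]
  have hbdd : BddAbove (Set.range fun i => (u i - a i) / w i) :=
    ⟨_, Set.forall_mem_range.2 fun i => hle i hι.some⟩
  refine ⟨⨆ i, (u i - a i) / w i, fun i => abs_le.2 ⟨?_, ?_⟩⟩
  · linarith [(le_div_iff₀ (hw i)).1 (ciSup_le fun j => hle j i)]
  · linarith [(div_le_iff₀ (hw i)).1 (le_ciSup hbdd i)]

variable {X ι : Type*} [MeasurableSpace X]

lemma mul_integral_sub_mul_integral_le {η q₁ q₂ : Measure X} (h₁ : η ≤ q₁) (h₂ : η ≤ q₂)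
    {u g : X → ℝ} (hu₁ : Integrable u q₁) (hu₂ : Integrable u q₂) (hg₁ : Integrable g q₁)
    (hg₂ : Integrable g q₂) (hug : ∀ x, |u x| ≤ g x) {m₁ m₂ : ℝ} (hm₁ : 0 ≤ m₁) (hm₂ : 0 ≤ m₂) :
    m₂ * ∫ x, u x ∂q₁ - m₁ * ∫ x, u x ∂q₂ ≤
      m₂ * ∫ x, g x ∂q₁ + m₁ * ∫ x, g x ∂q₂ - 2 * (min m₁ m₂ * ∫ x, g x ∂η) := by
  have hsub : ∀ x, 0 ≤ (g - u) x := fun x => sub_nonneg.2 (abs_le.1 (hug x)).2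
  have hadd : ∀ x, 0 ≤ (g + u) x := fun x => neg_le_iff_add_nonneg'.1 (abs_le.1 (hug x)).1
  have hle₁ := integral_mono_measure h₁ (.of_forall hsub) (hg₁.sub hu₁)
  have hle₂ := integral_mono_measure h₂ (.of_forall hadd) (hg₂.add hu₂)
  have hη₁ := mul_le_mul_of_nonneg_right (min_le_right m₁ m₂)
    (integral_nonneg (μ := η) hsub)
  have hη₂ := mul_le_mul_of_nonneg_right (min_le_left m₁ m₂)
    (integral_nonneg (μ := η) hadd)
  have hm₁' := mul_le_mul_of_nonneg_left hle₂ hm₁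
  have hm₂' := mul_le_mul_of_nonneg_left hle₁ hm₂
  simp only [integral_sub' (hg₁.mono_measure h₁) (hu₁.mono_measure h₁),
    integral_add' (hg₁.mono_measure h₁) (hu₁.mono_measure h₁), integral_sub' hg₁ hu₁,
    integral_add' hg₂ hu₂] at hη₁ hη₂ hm₁' hm₂'
  linarith

/-- A family of measures satisfying, relative to the integrals of `h`, a drift condition for `v`
with weights `w`, and a minorization by `η` over the indices whose weight is small. It yields a
contraction for the oscillation weighted by `h + β v`. -/
structure DriftMinorization (q : ι → Measure X) (η : Measure X) (v h : X → ℝ) (w : ι → ℝ)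
    (K β : ℝ) : Prop where
  integrable_weight : ∀ i, Integrable v (q i)
  integrable : ∀ i, Integrable h (q i)
  weight_nonneg : ∀ x, 0 ≤ v x
  index_weight_nonneg : ∀ i, 0 ≤ w i
  integral_pos : ∀ i, 0 < ∫ x, h x ∂(q i)
  drift : ∀ i, ∫ x, v x ∂(q i) ≤ w i / 2 + K * ∫ x, h x ∂(q i)
  minorization : ∀ i, w i < 16 * K * ∫ x, h x ∂(q i) →
    η ≤ q i ∧ 2 * (β * K) * ∫ x, h x ∂(q i) ≤ ∫ x, h x ∂η

namespace DriftMinorization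

variable {q : ι → Measure X} {η : Measure X} {v h : X → ℝ} {w : ι → ℝ} {K β : ℝ}
  (hq : DriftMinorization q η v h w K β)
include hq

lemma integral_le (hβ : 0 ≤ β) (i : ι) : ∫ x, (h x + β * v x) ∂(q i) ≤
    (1 + β * K) * ∫ x, h x ∂(q i) + β / 2 * w i := by
  rw [integral_add (hq.integrable i) ((hq.integrable_weight i).const_mul β), integral_const_mul]
  linarith [mul_le_mul_of_nonneg_left (hq.drift i) hβ]

lemma oscillation_le_of_far (hβ : 0 ≤ β) {α : ℝ} (hα : 3 / 4 ≤ α) (hαK : 1 - β * K ≤ α) {i j : ι}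
    (hij : 16 * K * ((∫ x, h x ∂(q i)) * ∫ x, h x ∂(q j)) ≤
      w i * ∫ x, h x ∂(q j) + w j * ∫ x, h x ∂(q i)) :
    (∫ x, h x ∂(q j)) * ∫ x, (h x + β * v x) ∂(q i) +
      (∫ x, h x ∂(q i)) * ∫ x, (h x + β * v x) ∂(q j) ≤
    α * ((∫ x, h x ∂(q j)) * (∫ x, h x ∂(q i) + β * w i) +
      (∫ x, h x ∂(q i)) * (∫ x, h x ∂(q j) + β * w j)) := by
  have hi := hq.integral_pos i
  have hj := hq.integral_pos j
  have hGi := mul_le_mul_of_nonneg_left (hq.integral_le hβ i) hj.le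
  have hGj := mul_le_mul_of_nonneg_left (hq.integral_le hβ j) hi.le
  have hwi := mul_nonneg (hq.index_weight_nonneg i) hj.le
  have hwj := mul_nonneg (hq.index_weight_nonneg j) hi.le
  generalize (∫ x, h x ∂(q i)) = s at *
  generalize (∫ x, h x ∂(q j)) = t at *
  have hfar := mul_le_mul_of_nonneg_left hij hβ
  have hst := mul_nonneg (sub_nonneg.2 hαK) (mul_pos hi hj).le
  have hweight := mul_nonneg (sub_nonneg.2 hα) (mul_nonneg hβ (add_nonneg hwi hwj))
  linarith

lemma oscillation_le_of_near (hβ : 0 ≤ β) {α : ℝ} (hα : 1 / 2 ≤ α) (hαK : 1 - β * K ≤ α)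
    {i j : ι} (hi : w i < 16 * K * ∫ x, h x ∂(q i)) (hj : w j < 16 * K * ∫ x, h x ∂(q j)) :
    (∫ x, h x ∂(q j)) * ∫ x, (h x + β * v x) ∂(q i) +
      (∫ x, h x ∂(q i)) * ∫ x, (h x + β * v x) ∂(q j) -
      2 * (min (∫ x, h x ∂(q i)) (∫ x, h x ∂(q j)) * ∫ x, (h x + β * v x) ∂η) ≤
    α * ((∫ x, h x ∂(q j)) * (∫ x, h x ∂(q i) + β * w i) +
      (∫ x, h x ∂(q i)) * (∫ x, h x ∂(q j) + β * w j)) := by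
  obtain ⟨hηi, hhi⟩ := hq.minorization i hi
  obtain ⟨-, hhj⟩ := hq.minorization j hj
  have hhη : ∫ x, h x ∂η ≤ ∫ x, (h x + β * v x) ∂η :=
    integral_mono ((hq.integrable i).mono_measure hηi)
      (((hq.integrable i).add ((hq.integrable_weight i).const_mul β)).mono_measure hηi)
      fun x => le_add_of_nonneg_right (mul_nonneg hβ (hq.weight_nonneg x))
  replace hi := hq.integral_pos i
  replace hj := hq.integral_pos j
  have hGi := mul_le_mul_of_nonneg_left (hq.integral_le hβ i) hj.le
  have hGj := mul_le_mul_of_nonneg_left (hq.integral_le hβ j) hi.le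
  have hwi := mul_nonneg (hq.index_weight_nonneg i) hj.le
  have hwj := mul_nonneg (hq.index_weight_nonneg j) hi.le
  generalize (∫ x, h x ∂(q i)) = s at *
  generalize (∫ x, h x ∂(q j)) = t at *
  have hoverlap : 2 * (β * K) * (s * t) ≤ min s t * ∫ x, (h x + β * v x) ∂η :=
    calc 2 * (β * K) * (s * t) = min s t * (2 * (β * K) * max s t) := by
          rw [← min_mul_max s t]; ring
      _ ≤ min s t * ∫ x, (h x + β * v x) ∂η := by
          refine mul_le_mul_of_nonneg_left (le_trans ?_ hhη) (le_min hi.le hj.le)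
          rcases max_choice s t with hst | hst <;> rw [hst] <;> assumption
  have hst := mul_nonneg (sub_nonneg.2 hαK) (mul_pos hi hj).le
  have hweight := mul_nonneg (sub_nonneg.2 hα) (mul_nonneg hβ (add_nonneg hwi hwj))
  linarith

lemma exists_abs_integral_sub_mul_le (hβ : 0 ≤ β) {f : X → ℝ} (hf : ∀ i, Integrable f (q i))
    {α a c : ℝ} (hα : 3 / 4 ≤ α) (hαK : 1 - β * K ≤ α) (ha : 0 ≤ a)
    (hfc : ∀ x, |f x - c * h x| ≤ a * (h x + β * v x)) :
    ∃ c', ∀ i, |∫ x, f x ∂(q i) - c' * ∫ x, h x ∂(q i)| ≤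
      α * a * (∫ x, h x ∂(q i) + β * w i) := by
  refine exists_abs_sub_mul_le hq.integral_pos fun i j => ?_
  have hu : ∀ i, Integrable (fun x => f x - c * h x) (q i) := fun i =>
    (hf i).sub ((hq.integrable i).const_mul c)
  have hg : ∀ i, Integrable (fun x => a * (h x + β * v x)) (q i) := fun i =>
    ((hq.integrable i).add ((hq.integrable_weight i).const_mul β)).const_mul a
  have hui : ∀ i, ∫ x, (f x - c * h x) ∂(q i) = ∫ x, f x ∂(q i) - c * ∫ x, h x ∂(q i) :=
    fun i => by rw [integral_sub (hf i) ((hq.integrable i).const_mul c), integral_const_mul]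
  have hosc := fun (ν : Measure X) (hi : ν ≤ q i) (hj : ν ≤ q j) =>
    mul_integral_sub_mul_integral_le hi hj (hu i) (hu j) (hg i) (hg j) hfc
      (hq.integral_pos i).le (hq.integral_pos j).le
  simp only [hui, integral_const_mul] at hosc
  have hi := hq.integral_pos i
  have hj := hq.integral_pos j
  rcases le_or_gt (16 * K * ((∫ x, h x ∂(q i)) * ∫ x, h x ∂(q j)))
    (w i * ∫ x, h x ∂(q j) + w j * ∫ x, h x ∂(q i)) with hfar | hnear
  · have hzero := hosc 0 (Measure.zero_le _) (Measure.zero_le _)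
    simp only [integral_zero_measure, mul_zero, sub_zero] at hzero
    linarith [mul_le_mul_of_nonneg_left (hq.oscillation_le_of_far hβ hα hαK hfar) ha]
  · have hi' : w i < 16 * K * ∫ x, h x ∂(q i) := by
      have := mul_nonneg (hq.index_weight_nonneg j) hi.le
      exact lt_of_mul_lt_mul_right (by linarith) hj.le
    have hj' : w j < 16 * K * ∫ x, h x ∂(q j) := by
      have := mul_nonneg (hq.index_weight_nonneg i) hj.le
      exact lt_of_mul_lt_mul_right (by linarith) hi.le
    linarith [hosc η (hq.minorization i hi').1 (hq.minorization j hj').1,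
      mul_le_mul_of_nonneg_left
        (hq.oscillation_le_of_near hβ (le_trans (by norm_num) hα) hαK hi' hj') ha]

end DriftMinorization

end Contraction

section Weight

variable {X : Type*} {V : X → ℝ}

lemma expWeight_pos (V : X → ℝ) (x : X) : 0 < expWeight V x := Real.exp_pos _

lemma one_le_expWeight (hV : ∀ x, 0 ≤ V x) (x : X) : 1 ≤ expWeight V x :=
  Real.one_le_exp (hV x)

lemma expWeight_le_of_mem_sublevel {d : ℝ} {x : X} (hx : x ∈ sublevel V d) :
    expWeight V x ≤ Real.exp d := Real.exp_le_exp.2 hx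

lemma vNorm_nonneg {v : X → ℝ} (hv : ∀ x, 0 < v x) (φ : X → ℝ) : 0 ≤ vNorm v φ :=
  Real.iSup_nonneg fun x => div_nonneg (abs_nonneg _) (hv x).le

variable [MeasurableSpace X]

lemma measurableSet_sublevel (hV : Measurable V) (d : ℝ) : MeasurableSet (sublevel V d) :=
  measurableSet_le hV measurable_const

lemma MemLv.abs_le {v φ : X → ℝ} (hφ : MemLv v φ) (hv : ∀ x, 0 < v x) (x : X) :
    |φ x| ≤ vNorm v φ * v x :=
  (div_le_iff₀ (hv x)).1 (le_ciSup hφ.2 x)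

lemma MemLv.integrable {v φ : X → ℝ} {η : Measure X} (hφ : MemLv v φ) (hv : ∀ x, 0 < v x)
    (hη : Integrable v η) : Integrable φ η :=
  (hη.const_mul _).mono' hφ.1.aestronglyMeasurable (.of_forall (hφ.abs_le hv))

lemma integrable_expWeight_iff (hV : Measurable V) {η : Measure X} :
    Integrable (expWeight V) η ↔ ∫⁻ x, ENNReal.ofReal (expWeight V x) ∂η ≠ ∞ :=
  (lintegral_ofReal_ne_top_iff_integrable hV.exp.aestronglyMeasurable
    (.of_forall fun x => (expWeight_pos V x).le)).symm

lemma isFiniteMeasure_of_integrable_expWeight (hV : ∀ x, 0 ≤ V x) {η : Measure X}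
    (hη : Integrable (expWeight V) η) : IsFiniteMeasure η := by
  have hone : Integrable (fun _ => (1 : ℝ)) η := hη.mono' aestronglyMeasurable_const
    (.of_forall fun x => by simpa using one_le_expWeight hV x)
  simpa [integrable_const_iff] using hone

lemma measureReal_univ_le_integral_expWeight (hV : ∀ x, 0 ≤ V x) {η : Measure X}
    (hη : Integrable (expWeight V) η) : η.real Set.univ ≤ ∫ x, expWeight V x ∂η := by
  have := isFiniteMeasure_of_integrable_expWeight hV hη
  simpa using integral_mono (integrable_const (1 : ℝ)) hη (one_le_expWeight hV)

lemma exists_measureReal_sublevel_pos (V : X → ℝ) (μ : Measure X) [IsFiniteMeasure μ] [NeZero μ]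
    (d₀ : ℝ) : ∃ r, d₀ ≤ r ∧ 0 < μ.real (sublevel V r) := by
  have hcover : ⋃ k : ℕ, sublevel V (d₀ + k) = Set.univ := Set.eq_univ_of_forall fun x => by
    obtain ⟨k, hk⟩ := exists_nat_ge (V x - d₀)
    exact Set.mem_iUnion.2 ⟨k, show V x ≤ d₀ + k by linarith⟩
  obtain ⟨k, hk⟩ := exists_measure_pos_of_not_measure_iUnion_null
    (μ := μ) (s := fun k : ℕ => sublevel V (d₀ + k)) (by simp [hcover, NeZero.ne μ])
  exact ⟨d₀ + k, by simp, ENNReal.toReal_pos hk.ne' (measure_ne_top _ _)⟩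

end Weight

/-- The part of the hypotheses that does not involve a model, from which all constants are chosen:
`m d` is a minorant of the kernels started in `C_d`. -/
structure StabilityData {X : Type*} [MeasurableSpace X] (V : X → ℝ) (δ d₀ : ℝ)
    (m : ℝ → Measure X) : Prop where
  measurable_V : Measurable V
  nonneg_V : ∀ x, 0 ≤ V x
  delta_pos : 0 < δ
  isFiniteMeasure : ∀ d, d₀ ≤ d → IsFiniteMeasure (m d)
  measure_pos : ∀ r d, d₀ ≤ r → r ≤ d → 0 < m d (sublevel V r)

/-- Time-uniform drift for `V` together with two-sided local bounds: on `C_d` every kernel dominates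
`m d`, and its restriction to `C_d` is at most `R d • m d`. For the hypotheses of the paper,
`m d` is `ε_d⁻ • ν_d` restricted to `C_d` and `R d = ε_d⁺ / ε_d⁻`. -/
structure StabilityConditions {X : Type*} [MeasurableSpace X] (F : FKModel X) (V : X → ℝ)
    (δ d₀ : ℝ) (b : ℝ → ℝ) (m : ℝ → Measure X) (R : ℝ → NNReal) : Prop
    extends StabilityData V δ d₀ m where
  lintegral_Q_le : ∀ d, d₀ ≤ d → ∀ n x,
    ∫⁻ y, ENNReal.ofReal (expWeight V y) ∂(F.Q (n + 1) x) ≤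
      ENNReal.ofReal (Real.exp
        (V x * (1 - δ) + b d * (sublevel V d).indicator (fun _ => (1 : ℝ)) x))
  le_Q : ∀ d, d₀ ≤ d → ∀ n, ∀ x ∈ sublevel V d, m d ≤ F.Q (n + 1) x
  restrict_Q_le : ∀ d, d₀ ≤ d → ∀ n, ∀ x ∈ sublevel V d,
    (F.Q (n + 1) x).restrict (sublevel V d) ≤ R d • m d

section Stability

variable {X : Type*} [MeasurableSpace X] {F : FKModel X} {V : X → ℝ} {δ d₀ r d : ℝ}
  {b : ℝ → ℝ} {m : ℝ → Measure X} {R : ℝ → NNReal} {μ : Measure X} {p n : ℕ} {x : X}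

namespace StabilityData

variable (hS : StabilityData V δ d₀ m)
include hS

lemma measureReal_pos (hr : d₀ ≤ r) (hd : r ≤ d) : 0 < (m d).real (sublevel V r) := by
  have := hS.isFiniteMeasure d (hr.trans hd)
  exact ENNReal.toReal_pos (hS.measure_pos r d hr hd).ne' (measure_ne_top _ _)

lemma exists_exp_neg_le {ε : ℝ} (hε : 0 < ε) (r : ℝ) :
    ∃ d, r ≤ d ∧ Real.exp (-(δ * d)) ≤ ε := by
  refine ⟨max r (-Real.log ε / δ), le_max_left _ _, ?_⟩
  rw [← Real.le_log_iff_exp_le hε]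
  have := (div_le_iff₀' hS.delta_pos).1 (le_max_right r (-Real.log ε / δ))
  linarith

end StabilityData

namespace StabilityConditions

variable (hF : StabilityConditions F V δ d₀ b m R)
include hF

lemma integrable_Q (n : ℕ) (x : X) : Integrable (expWeight V) (F.Q (n + 1) x) :=
  (integrable_expWeight_iff hF.measurable_V).2
    ((hF.lintegral_Q_le d₀ le_rfl n x).trans_lt ENNReal.ofReal_lt_top).ne

lemma integral_Q_le_exp (hd : d₀ ≤ d) (n : ℕ) (x : X) :
    ∫ y, expWeight V y ∂(F.Q (n + 1) x) ≤ Real.exp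
      (V x * (1 - δ) + b d * (sublevel V d).indicator (fun _ => (1 : ℝ)) x) := by
  have h := hF.lintegral_Q_le d hd n x
  rwa [← ofReal_integral_eq_lintegral_ofReal (hF.integrable_Q n x)
    (.of_forall fun _ => (expWeight_pos V _).le),
    ENNReal.ofReal_le_ofReal_iff (Real.exp_pos _).le] at h

lemma integral_Q_le_exp_mul (hd : d₀ ≤ d) (n : ℕ) (x : X) :
    ∫ y, expWeight V y ∂(F.Q (n + 1) x) ≤ Real.exp |b d| * Real.exp (V x * (1 - δ)) := by
  refine (hF.integral_Q_le_exp hd n x).trans ?_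
  rw [← Real.exp_add, add_comm |b d|]
  gcongr
  by_cases hx : x ∈ sublevel V d
  · simpa [hx] using le_abs_self (b d)
  · simp [hx]

lemma integral_Q_le_mul (hd : d₀ ≤ d) (n : ℕ) (x : X) :
    ∫ y, expWeight V y ∂(F.Q (n + 1) x) ≤ Real.exp |b d| * expWeight V x := by
  refine (hF.integral_Q_le_exp_mul hd n x).trans ?_
  unfold expWeight
  gcongr
  nlinarith [hF.nonneg_V x, hF.delta_pos]

lemma integral_Q_le_of_mem (hd : d₀ ≤ d) (n : ℕ) (hx : x ∈ sublevel V d) :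
    ∫ y, expWeight V y ∂(F.Q (n + 1) x) ≤ Real.exp (|b d| + d) := by
  rw [Real.exp_add]
  refine (hF.integral_Q_le_mul hd n x).trans ?_
  gcongr
  exact expWeight_le_of_mem_sublevel hx

lemma integral_Q_le_of_notMem (hd : d₀ ≤ d) (n : ℕ) (hx : x ∉ sublevel V d) :
    ∫ y, expWeight V y ∂(F.Q (n + 1) x) ≤ Real.exp (-(δ * d)) * expWeight V x := by
  refine (hF.integral_Q_le_exp hd n x).trans ?_
  have hdx : d < V x := not_le.1 hx
  rw [Set.indicator_of_notMem hx, expWeight, ← Real.exp_add, Real.exp_le_exp]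
  nlinarith [hF.delta_pos]

lemma integrable_comp {η : Measure X} (hη : Integrable (expWeight V) η) (n : ℕ) :
    Integrable (expWeight V) (F.Q (n + 1) ∘ₘ η) := by
  have hm : Measurable (expWeight V) := hF.measurable_V.exp
  refine (Measure.integrable_comp_iff hm.aestronglyMeasurable).2
    ⟨.of_forall (hF.integrable_Q n), ?_⟩
  refine (hη.const_mul (Real.exp |b d₀|)).mono'
    hm.stronglyMeasurable.norm.integral_kernel.aestronglyMeasurable (.of_forall fun x => ?_)
  rw [Real.norm_of_nonneg (integral_nonneg fun _ => norm_nonneg _)]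
  simpa only [Real.norm_of_nonneg (expWeight_pos V _).le] using hF.integral_Q_le_mul le_rfl n x

lemma integrable_semigroup (h : p ≤ n) (x : X) : Integrable (expWeight V) (F.semigroup p n x) := by
  induction n, h using Nat.le_induction with
  | base =>
    rw [F.semigroup_self, Kernel.id_apply]
    exact integrable_dirac' hF.measurable_V.exp.stronglyMeasurable (by simp)
  | succ n h ih =>
    rw [F.semigroup_succ h, Kernel.comp_apply]
    exact hF.integrable_comp ih n

lemma isFiniteMeasure_semigroup (h : p ≤ n) (x : X) : IsFiniteMeasure (F.semigroup p n x) :=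
  isFiniteMeasure_of_integrable_expWeight hF.nonneg_V (hF.integrable_semigroup h x)

lemma integrable_gamma (hμ : Integrable (expWeight V) μ) (n : ℕ) :
    Integrable (expWeight V) (F.gamma μ n) := by
  induction n with
  | zero => rwa [F.gamma_zero]
  | succ n ih => rw [F.gamma_succ]; exact hF.integrable_comp ih n

lemma isFiniteMeasure_gamma (hμ : Integrable (expWeight V) μ) (n : ℕ) :
    IsFiniteMeasure (F.gamma μ n) :=
  isFiniteMeasure_of_integrable_expWeight hF.nonneg_V (hF.integrable_gamma hμ n)

lemma integral_Q_le_add_indicator (hd : d₀ ≤ d) (n : ℕ) (x : X) :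
    ∫ y, expWeight V y ∂(F.Q (n + 1) x) ≤ Real.exp (-(δ * d)) * expWeight V x +
      (sublevel V d).indicator (fun _ => Real.exp (|b d| + d)) x := by
  by_cases hx : x ∈ sublevel V d
  · rw [Set.indicator_of_mem hx]
    exact (hF.integral_Q_le_of_mem hd n hx).trans
      (le_add_of_nonneg_left (mul_nonneg (Real.exp_pos _).le (expWeight_pos V x).le))
  · simpa [hx] using hF.integral_Q_le_of_notMem hd n hx

lemma integral_gamma_succ_le (hμ : Integrable (expWeight V) μ) (hd : d₀ ≤ d) (n : ℕ) :
    ∫ y, expWeight V y ∂(F.gamma μ (n + 1)) ≤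
      Real.exp (-(δ * d)) * ∫ y, expWeight V y ∂(F.gamma μ n) +
        Real.exp (|b d| + d) * (F.gamma μ n).real (sublevel V d) := by
  have hγ := hF.integrable_gamma hμ n
  have hγ' := hF.integrable_gamma hμ (n + 1)
  have := hF.isFiniteMeasure_gamma hμ n
  have hs := measurableSet_sublevel hF.measurable_V d
  have hind : Integrable ((sublevel V d).indicator fun _ => Real.exp (|b d| + d))
      (F.gamma μ n) := (integrable_const _).indicator hs
  rw [F.gamma_succ] at hγ' ⊢
  calc ∫ y, expWeight V y ∂(F.Q (n + 1) ∘ₘ F.gamma μ n)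
      = ∫ x, ∫ y, expWeight V y ∂(F.Q (n + 1) x) ∂(F.gamma μ n) := integral_comp_measure hγ'
    _ ≤ ∫ x, (Real.exp (-(δ * d)) * expWeight V x +
          (sublevel V d).indicator (fun _ => Real.exp (|b d| + d)) x) ∂(F.gamma μ n) :=
        integral_mono (integrable_integral_of_comp_measure hγ') ((hγ.const_mul _).add hind)
          (hF.integral_Q_le_add_indicator hd n)
    _ = _ := by
        rw [integral_add (hγ.const_mul _) hind, integral_const_mul,
          integral_indicator_const _ hs, smul_eq_mul, mul_comm (Real.exp (|b d| + d))]

lemma measureReal_mul_le_gamma_succ (hμ : Integrable (expWeight V) μ) (hd : d₀ ≤ d) (r : ℝ)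
    (n : ℕ) : (m d).real (sublevel V r) * (F.gamma μ n).real (sublevel V d) ≤
      (F.gamma μ (n + 1)).real (sublevel V r) := by
  have := hF.isFiniteMeasure_gamma hμ (n + 1)
  rw [F.gamma_succ] at this ⊢
  exact measureReal_mul_le_comp_measure (hF.le_Q d hd n) (measurableSet_sublevel hF.measurable_V r)

end StabilityConditions

/-- Uniform tightness of the flow: `γ_n(v)` is at most `B` times the `γ_n`-mass of `C_r`. -/
structure FlowBound (F : FKModel X) (V : X → ℝ) (μ : Measure X) (r B : ℝ) : Prop where
  integrable : ∀ n, Integrable (expWeight V) (F.gamma μ n)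
  sublevel_pos : ∀ n, 0 < (F.gamma μ n).real (sublevel V r)
  integral_le : ∀ n, ∫ y, expWeight V y ∂(F.gamma μ n) ≤ B * (F.gamma μ n).real (sublevel V r)

namespace FlowBound

variable {B : ℝ} (h : FlowBound F V μ r B)
include h

lemma isFiniteMeasure (hV : ∀ x, 0 ≤ V x) (n : ℕ) : IsFiniteMeasure (F.gamma μ n) :=
  isFiniteMeasure_of_integrable_expWeight hV (h.integrable n)

lemma neZero (n : ℕ) : NeZero (F.gamma μ n) :=
  ⟨fun h0 => by simpa [h0] using h.sublevel_pos n⟩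

lemma measureReal_univ_le (hV : ∀ x, 0 ≤ V x) (n : ℕ) :
    (F.gamma μ n).real Set.univ ≤ B * (F.gamma μ n).real (sublevel V r) :=
  (measureReal_univ_le_integral_expWeight hV (h.integrable n)).trans (h.integral_le n)

end FlowBound

lemma StabilityConditions.flowBound (hF : StabilityConditions F V δ d₀ b m R)
    (hμ : Integrable (expWeight V) μ) (hr : d₀ ≤ r) (hd : r ≤ d)
    (hδ : Real.exp (-(δ * d)) ≤ (m r).real (sublevel V r) / 2)
    (hμr : 0 < μ.real (sublevel V r)) {B : ℝ} (hB : 0 ≤ B)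
    (hBd : 2 * Real.exp (|b d| + d) ≤ B * (m d).real (sublevel V r))
    (hBμ : ∫ y, expWeight V y ∂μ ≤ B * μ.real (sublevel V r)) : FlowBound F V μ r B := by
  have hkeep := hF.measureReal_mul_le_gamma_succ hμ hr r
  refine ⟨hF.integrable_gamma hμ, fun n => ?_, fun n => ?_⟩
  · induction n with
    | zero => rwa [F.gamma_zero]
    | succ n ih => exact (mul_pos (hF.measureReal_pos hr le_rfl) ih).trans_le (hkeep n)
  · induction n with
    | zero => rwa [F.gamma_zero]
    | succ n ih =>
      have hfar : Real.exp (-(δ * d)) * ∫ y, expWeight V y ∂(F.gamma μ n) ≤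
          B / 2 * (F.gamma μ (n + 1)).real (sublevel V r) :=
        calc _ ≤ (m r).real (sublevel V r) / 2 * (B * (F.gamma μ n).real (sublevel V r)) := by
              gcongr
              exact integral_nonneg fun y => (expWeight_pos V y).le
          _ = B / 2 * ((m r).real (sublevel V r) * (F.gamma μ n).real (sublevel V r)) := by ring
          _ ≤ _ := by gcongr; exact hkeep n
      have hnear : Real.exp (|b d| + d) * (F.gamma μ n).real (sublevel V d) ≤
          B / 2 * (F.gamma μ (n + 1)).real (sublevel V r) :=
        calc _ ≤ B / 2 * (m d).real (sublevel V r) * (F.gamma μ n).real (sublevel V d) := by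
              gcongr; linarith
          _ = B / 2 * ((m d).real (sublevel V r) * (F.gamma μ n).real (sublevel V d)) := by ring
          _ ≤ _ := by gcongr; exact hF.measureReal_mul_le_gamma_succ hμ (hr.trans hd) r n
      linarith [hF.integral_gamma_succ_le hμ (hr.trans hd) n]

lemma StabilityData.exists_flowBound [IsProbabilityMeasure μ] (hS : StabilityData V δ d₀ m)
    (hμ : Integrable (expWeight V) μ) (b : ℝ → ℝ) (R : ℝ → NNReal) :
    ∃ r B, d₀ ≤ r ∧ 0 < B ∧
      ∀ F, StabilityConditions F V δ d₀ b m R → FlowBound F V μ r B := by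
  obtain ⟨r, hr, hμr⟩ := exists_measureReal_sublevel_pos V μ d₀
  obtain ⟨d, hd, hδ⟩ := hS.exists_exp_neg_le (half_pos (hS.measureReal_pos hr le_rfl)) r
  have hθ := hS.measureReal_pos hr hd
  refine ⟨r, max (2 * Real.exp (|b d| + d) / (m d).real (sublevel V r))
    ((∫ y, expWeight V y ∂μ) / μ.real (sublevel V r)), hr, lt_max_of_lt_left (by positivity),
    fun F hF => hF.flowBound hμ hr hd hδ hμr (le_max_of_le_left (by positivity)) ?_ ?_⟩
  · exact (div_le_iff₀ hθ).1 (le_max_left _ _)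
  · exact (div_le_iff₀ hμr).1 (le_max_right _ _)

/-- `H` is a nonnegative measurable function, at least `c` on `C_r` and at most `C • e^V`. -/
structure WeightBounds (V : X → ℝ) (r c C : ℝ) (H : X → ℝ) : Prop where
  measurable : Measurable H
  nonneg : ∀ x, 0 ≤ H x
  le_of_mem : ∀ x ∈ sublevel V r, c ≤ H x
  le_mul : ∀ x, H x ≤ C * expWeight V x

namespace WeightBounds

variable {c C : ℝ} {H : X → ℝ} {η : Measure X}

lemma integrable (h : WeightBounds V r c C H) (hη : Integrable (expWeight V) η) :
    Integrable H η :=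
  (hη.const_mul C).mono' h.measurable.aestronglyMeasurable
    (.of_forall fun x => (abs_of_nonneg (h.nonneg x)).trans_le (h.le_mul x))

lemma integral_le (h : WeightBounds V r c C H) (hη : Integrable (expWeight V) η) :
    ∫ x, H x ∂η ≤ C * ∫ x, expWeight V x ∂η := by
  rw [← integral_const_mul]
  exact integral_mono (h.integrable hη) (hη.const_mul C) h.le_mul

lemma mul_le_integral [IsFiniteMeasure η] (h : WeightBounds V r c C H) (hV : Measurable V)
    (hH : Integrable H η) : η.real (sublevel V r) * c ≤ ∫ x, H x ∂η :=
  measureReal_mul_le_integral (measurableSet_sublevel hV r) h.nonneg hH h.le_of_mem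

end WeightBounds

namespace StabilityConditions

variable (hF : StabilityConditions F V δ d₀ b m R) {c C : ℝ} {H : X → ℝ}
include hF

lemma integrable_minorant (hd : d₀ ≤ d) (hx : x ∈ sublevel V d) :
    Integrable (expWeight V) (m d) :=
  (hF.integrable_Q 0 x).mono_measure (hF.le_Q d hd 0 x hx)

lemma integral_minorant_le_integral_Q (hH : WeightBounds V r c C H) (hd : d₀ ≤ d) (n : ℕ)
    (hx : x ∈ sublevel V d) : ∫ y, H y ∂(m d) ≤ ∫ y, H y ∂(F.Q (n + 1) x) :=
  integral_mono_measure (hF.le_Q d hd n x hx) (.of_forall hH.nonneg)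
    (hH.integrable (hF.integrable_Q n x))

lemma mul_le_integral_minorant (hH : WeightBounds V r c C H) (hd : d₀ ≤ d)
    (hx : x ∈ sublevel V d) : (m d).real (sublevel V r) * c ≤ ∫ y, H y ∂(m d) :=
  have := hF.isFiniteMeasure d hd
  hH.mul_le_integral hF.measurable_V (hH.integrable (hF.integrable_minorant hd hx))

lemma mul_le_integral_Q (hH : WeightBounds V r c C H) (hd : d₀ ≤ d) (n : ℕ)
    (hx : x ∈ sublevel V d) :
    (m d).real (sublevel V r) * c ≤ ∫ y, H y ∂(F.Q (n + 1) x) :=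
  (hF.mul_le_integral_minorant hH hd hx).trans (hF.integral_minorant_le_integral_Q hH hd n hx)

lemma setIntegral_Q_le (hH : WeightBounds V r c C H) (hd : d₀ ≤ d) (n : ℕ)
    (hx : x ∈ sublevel V d) :
    ∫ y in sublevel V d, H y ∂(F.Q (n + 1) x) ≤ R d * ∫ y, H y ∂(m d) := by
  have hint := (hH.integrable (hF.integrable_minorant hd hx)).smul_measure_nnreal (c := R d)
  refine (integral_mono_measure (hF.restrict_Q_le d hd n x hx) (.of_forall hH.nonneg)
    hint).trans_eq ?_
  rw [integral_smul_nnreal_measure, NNReal.smul_def, smul_eq_mul]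

lemma setIntegral_compl_Q_le (hH : WeightBounds V r c C H) {a : ℝ} (ha : 0 ≤ a)
    (hHa : ∀ y ∉ sublevel V d, H y ≤ a * expWeight V y) (n : ℕ) (x : X) :
    ∫ y in (sublevel V d)ᶜ, H y ∂(F.Q (n + 1) x) ≤
      a * (Real.exp |b d₀| * expWeight V x) := by
  have hv := hF.integrable_Q n x
  calc ∫ y in (sublevel V d)ᶜ, H y ∂(F.Q (n + 1) x)
      ≤ ∫ y in (sublevel V d)ᶜ, a * expWeight V y ∂(F.Q (n + 1) x) :=
        setIntegral_mono_on (hH.integrable hv).integrableOn (hv.const_mul a).integrableOn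
          (measurableSet_sublevel hF.measurable_V d).compl hHa
    _ ≤ ∫ y, a * expWeight V y ∂(F.Q (n + 1) x) :=
        setIntegral_le_integral (hv.const_mul a)
          (.of_forall fun y => mul_nonneg ha (expWeight_pos V y).le)
    _ = a * ∫ y, expWeight V y ∂(F.Q (n + 1) x) := integral_const_mul _ _
    _ ≤ _ := by gcongr; exact hF.integral_Q_le_mul le_rfl n x

end StabilityConditions

/-- The bounds propagated by backward induction for `Q_{p,n}(1)`: relative to its lower bound `j`
on `C_r`, the function is at most `A • e^V`, and smaller by a further factor `k` outside `C_d`. -/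
structure MassProfile (V : X → ℝ) (r d k A j : ℝ) (H : X → ℝ) : Prop
    extends WeightBounds V r j (A * j) H where
  pos : 0 < j
  le_of_notMem : ∀ x ∉ sublevel V d, H x ≤ k * (A * j) * expWeight V x

section MassProfile

variable {k A : ℝ}

lemma massProfile_one (hV : ∀ x, 0 ≤ V x) (r d : ℝ) (hk : k ≤ 1) (hA : 0 ≤ A)
    (hkA : 1 ≤ k * A) : MassProfile V r d k A 1 fun _ => 1 where
  measurable := measurable_const
  nonneg _ := zero_le_one
  le_of_mem _ _ := le_rfl
  le_mul x := by
    rw [mul_one]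
    exact one_le_mul_of_one_le_of_one_le (hkA.trans (mul_le_of_le_one_left hA hk))
      (one_le_expWeight hV x)
  pos := one_pos
  le_of_notMem x _ := by
    rw [mul_one]
    exact one_le_mul_of_one_le_of_one_le hkA (one_le_expWeight hV x)

variable {j : ℝ} {H : X → ℝ}

namespace MassProfile

lemma integral_Q_le_of_notMem (hH : MassProfile V r d k A j H)
    (hF : StabilityConditions F V δ d₀ b m R) (hd : d₀ ≤ d) (hA : 0 ≤ A)
    {θ : ℝ} (hδ : Real.exp (-(δ * d)) ≤ k * θ) (n : ℕ) (hx : x ∉ sublevel V d) :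
    ∫ y, H y ∂(F.Q (n + 1) x) ≤ k * (A * (θ * j)) * expWeight V x :=
  have hv := expWeight_pos V x
  have hj := hH.pos
  calc ∫ y, H y ∂(F.Q (n + 1) x) ≤ A * j * ∫ y, expWeight V y ∂(F.Q (n + 1) x) :=
        hH.integral_le (hF.integrable_Q n x)
    _ ≤ A * j * (k * θ * expWeight V x) := by
        gcongr
        exact (hF.integral_Q_le_of_notMem hd n hx).trans (by gcongr)
    _ = k * (A * (θ * j)) * expWeight V x := by ring

lemma integral_Q_le_of_mem (hH : MassProfile V r d k A j H)
    (hF : StabilityConditions F V δ d₀ b m R) (hd : d₀ ≤ d) (hk : 0 ≤ k) (hA : 0 ≤ A) {θ : ℝ}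
    (hkE : 2 * (k * Real.exp |b d₀|) ≤ θ) (hAR : 2 * R d ≤ A) (n : ℕ) (hx : x ∈ sublevel V d) :
    ∫ y, H y ∂(F.Q (n + 1) x) ≤
      A / 2 * (∫ y, H y ∂(m d)) + A / 2 * (θ * j) * expWeight V x := by
  have hj := hH.pos
  have hi : 0 ≤ ∫ y, H y ∂(m d) := integral_nonneg hH.nonneg
  have hv := expWeight_pos V x
  rw [← integral_add_compl (measurableSet_sublevel hF.measurable_V d)
    (hH.integrable (hF.integrable_Q n x))]
  refine add_le_add ((hF.setIntegral_Q_le hH.toWeightBounds hd n hx).trans ?_)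
    ((hF.setIntegral_compl_Q_le hH.toWeightBounds (by positivity) hH.le_of_notMem n x).trans ?_)
  · gcongr
    linarith
  · calc k * (A * j) * (Real.exp |b d₀| * expWeight V x)
        = A / 2 * (2 * (k * Real.exp |b d₀|) * j) * expWeight V x := by ring
      _ ≤ _ := by gcongr

lemma exists_integral_Q (hH : MassProfile V r d k A j H)
    (hF : StabilityConditions F V δ d₀ b m R) (hr : d₀ ≤ r) (hrd : r ≤ d) (hk : 0 ≤ k)
    (hA : 0 ≤ A) (hδ : Real.exp (-(δ * d)) ≤ k * (m r).real (sublevel V r))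
    (hkE : 2 * (k * Real.exp |b d₀|) ≤ (m r).real (sublevel V r)) (hk1 : k ≤ 1)
    (hAR : 2 * R d ≤ A) (n : ℕ) :
    ∃ j', MassProfile V r d k A j' fun x => ∫ y, H y ∂(F.Q (n + 1) x) := by
  have hd := hr.trans hrd
  set θ := (m r).real (sublevel V r)
  set j' := max (θ * j) (∫ y, H y ∂(m d))
  have hθj : θ * j ≤ j' := le_max_left _ _
  have hij : ∫ y, H y ∂(m d) ≤ j' := le_max_right _ _
  have hj' : 0 < j' := (mul_pos (hF.measureReal_pos hr le_rfl) hH.pos).trans_le hθj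
  have hout : ∀ x ∉ sublevel V d, ∫ y, H y ∂(F.Q (n + 1) x) ≤ k * (A * j') * expWeight V x :=
    fun x hx => (hH.integral_Q_le_of_notMem hF hd hA hδ n hx).trans <| by
      have := expWeight_pos V x
      gcongr
  refine ⟨j', ⟨?_, fun x => integral_nonneg hH.nonneg, fun x hx => max_le ?_ ?_, fun x => ?_⟩,
    hj', hout⟩
  · exact (hH.measurable.stronglyMeasurable.integral_kernel (κ := F.Q (n + 1))).measurable
  · exact hF.mul_le_integral_Q hH.toWeightBounds hr n hx
  · exact hF.integral_minorant_le_integral_Q hH.toWeightBounds hd n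
      (show V x ≤ d from le_trans hx hrd)
  · have hv := one_le_expWeight hF.nonneg_V x
    by_cases hx : x ∈ sublevel V d
    · calc ∫ y, H y ∂(F.Q (n + 1) x)
          ≤ A / 2 * (∫ y, H y ∂(m d)) + A / 2 * (θ * j) * expWeight V x :=
            hH.integral_Q_le_of_mem hF hd hk hA hkE hAR n hx
        _ ≤ A / 2 * j' * expWeight V x + A / 2 * j' * expWeight V x := by
            have hi : A / 2 * (∫ y, H y ∂(m d)) ≤ A / 2 * j' * expWeight V x :=
              (by gcongr : _ ≤ A / 2 * j').trans (le_mul_of_one_le_right (by positivity) hv)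
            have hj : A / 2 * (θ * j) * expWeight V x ≤ A / 2 * j' * expWeight V x := by gcongr
            exact add_le_add hi hj
        _ = A * j' * expWeight V x := by ring
    · calc ∫ y, H y ∂(F.Q (n + 1) x) ≤ k * (A * j') * expWeight V x := hout x hx
        _ ≤ A * j' * expWeight V x :=
            mul_le_mul_of_nonneg_right (mul_le_of_le_one_left (mul_nonneg hA hj'.le) hk1)
              (expWeight_pos V x).le

end MassProfile

lemma StabilityConditions.exists_massProfile (hF : StabilityConditions F V δ d₀ b m R)
    (hr : d₀ ≤ r) (hrd : r ≤ d) (hk : 0 ≤ k) (hA : 0 ≤ A)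
    (hδ : Real.exp (-(δ * d)) ≤ k * (m r).real (sublevel V r))
    (hkE : 2 * (k * Real.exp |b d₀|) ≤ (m r).real (sublevel V r)) (hk1 : k ≤ 1)
    (hkA : 1 ≤ k * A) (hAR : 2 * R d ≤ A) (hpn : p ≤ n) :
    ∃ j, MassProfile V r d k A j (F.semigroupOp p n fun _ => 1) := by
  induction hpn using Nat.decreasingInduction with
  | self =>
    rw [funext (F.semigroupOp_self n measurable_const)]
    exact ⟨1, massProfile_one hF.nonneg_V r d hk1 hA hkA⟩
  | of_succ p hpn ih =>
    obtain ⟨j, hj⟩ := ih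
    have hrec : (F.semigroupOp p n fun _ => 1) =
        fun x => ∫ y, F.semigroupOp (p + 1) n (fun _ => 1) y ∂(F.Q (p + 1) x) := funext fun x =>
      have := hF.isFiniteMeasure_semigroup hpn.le x
      F.semigroupOp_eq_integral_Q hpn (integrable_const 1)
    rw [hrec]
    exact hj.exists_integral_Q hF hr hrd hk hA hδ hkE hk1 hAR p

end MassProfile

lemma StabilityData.exists_weightBounds_semigroupOp_one (hS : StabilityData V δ d₀ m)
    (hr : d₀ ≤ r) (b : ℝ → ℝ) (R : ℝ → NNReal) :
    ∃ A, 0 < A ∧ ∀ F, StabilityConditions F V δ d₀ b m R → ∀ p n, p ≤ n →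
      ∃ j, 0 < j ∧ WeightBounds V r j (A * j) (F.semigroupOp p n fun _ => 1) := by
  have hθ := hS.measureReal_pos hr le_rfl
  set θ := (m r).real (sublevel V r)
  set k := min 1 (θ / (2 * Real.exp |b d₀|))
  have hk : 0 < k := lt_min one_pos (by positivity)
  have hkE : 2 * (k * Real.exp |b d₀|) ≤ θ := by
    linarith [(le_div_iff₀ (by positivity)).1 (min_le_right 1 (θ / (2 * Real.exp |b d₀|)))]
  obtain ⟨d, hrd, hδ⟩ := hS.exists_exp_neg_le (mul_pos hk hθ) r
  have hA : 0 < max (1 / k) (2 * R d) := lt_max_of_lt_left (by positivity)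
  refine ⟨_, hA, fun F hF p n hpn => ?_⟩
  obtain ⟨j, hj⟩ := hF.exists_massProfile hr hrd hk.le hA.le hδ hkE (min_le_left _ _)
    ((div_le_iff₀' hk).1 (le_max_left _ _)) (le_max_right _ _) hpn
  exact ⟨j, hj.pos, hj.toWeightBounds⟩

/-- Bounds on the normalised flow: tightness, a lower bound on the eigenvalues `λ_n`, and
comparability of the functions `h_{p,n}` to `e^V` above and, on `C_r`, to a constant below. -/
structure UniformBounds (F : FKModel X) (V : X → ℝ) (μ : Measure X) (r B l D : ℝ) : Prop
    extends FlowBound F V μ r B where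
  le_lam : ∀ n, l ≤ F.lam μ n
  weightBounds : ∀ p n, p ≤ n → WeightBounds V r D⁻¹ D (F.h μ p n)

namespace FlowBound

variable {A B j : ℝ} (h : FlowBound F V μ r B)
include h

lemma le_lam (hF : StabilityConditions F V δ d₀ b m R) (hr : d₀ ≤ r) (hB : 0 < B) (n : ℕ) :
    (m r).real (sublevel V r) / B ≤ F.lam μ n := by
  have := h.isFiniteMeasure hF.nonneg_V
  have := h.neZero
  rw [F.lam_eq, div_le_div_iff₀ hB measureReal_univ_pos]
  calc (m r).real (sublevel V r) * (F.gamma μ n).real Set.univ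
      ≤ (m r).real (sublevel V r) * (B * (F.gamma μ n).real (sublevel V r)) := by
        gcongr
        exact h.measureReal_univ_le hF.nonneg_V n
    _ = (m r).real (sublevel V r) * (F.gamma μ n).real (sublevel V r) * B := by ring
    _ ≤ (F.gamma μ (n + 1)).real (sublevel V r) * B := by
        gcongr
        exact hF.measureReal_mul_le_gamma_succ (F.gamma_zero μ ▸ h.integrable 0) hr r n
    _ ≤ (F.gamma μ (n + 1)).real Set.univ * B := by
        gcongr ?_ * B
        exact measureReal_mono (Set.subset_univ _)

lemma prod_lam_mem_Icc (hV : Measurable V) (hV0 : ∀ x, 0 ≤ V x) (hA : 0 ≤ A) (hB : 0 < B)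
    (hj : 0 ≤ j) (hpn : p ≤ n)
    (hH : WeightBounds V r j (A * j) (F.semigroupOp p n fun _ => 1)) :
    ∏ q ∈ Finset.Ico p n, F.lam μ q ∈ Set.Icc (j / B) (A * B * j) := by
  have := h.isFiniteMeasure hV0
  have := h.neZero
  have hpos : 0 < (F.gamma μ p).real Set.univ := measureReal_univ_pos
  have hone : Integrable (fun _ => (1 : ℝ)) (F.gamma μ n) := integrable_const 1
  have hmass : (F.gamma μ n).real Set.univ =
      ∫ y, F.semigroupOp p n (fun _ => 1) y ∂(F.gamma μ p) := by
    rw [← F.integral_gamma_eq hpn hone, integral_const, smul_eq_mul, mul_one]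
  rw [F.prod_lam_eq hpn, hmass, Set.mem_Icc, div_le_div_iff₀ hB hpos, div_le_iff₀ hpos]
  constructor
  · calc j * (F.gamma μ p).real Set.univ ≤ j * (B * (F.gamma μ p).real (sublevel V r)) := by
          gcongr
          exact h.measureReal_univ_le hV0 p
      _ = (F.gamma μ p).real (sublevel V r) * j * B := by ring
      _ ≤ _ := by
          gcongr
          exact hH.mul_le_integral hV (F.integrable_semigroupOp_gamma hpn hone)
  · calc ∫ y, F.semigroupOp p n (fun _ => 1) y ∂(F.gamma μ p)
        ≤ A * j * ∫ y, expWeight V y ∂(F.gamma μ p) := hH.integral_le (h.integrable p)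
      _ ≤ A * j * (B * (F.gamma μ p).real Set.univ) := by
          gcongr
          exact (h.integral_le p).trans
            (mul_le_mul_of_nonneg_left (measureReal_mono (Set.subset_univ _)) hB.le)
      _ = A * B * j * (F.gamma μ p).real Set.univ := by ring

lemma weightBounds_h (hV : Measurable V) (hV0 : ∀ x, 0 ≤ V x) (hA : 0 < A)
    (hB : 0 < B) (hj : 0 < j) (hpn : p ≤ n)
    (hH : WeightBounds V r j (A * j) (F.semigroupOp p n fun _ => 1)) :
    WeightBounds V r (A * B)⁻¹ (A * B) (F.h μ p n) := by
  obtain ⟨hlow, hup⟩ := h.prod_lam_mem_Icc hV hV0 hA.le hB hj.le hpn hH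
  have hprod := (div_pos hj hB).trans_le hlow
  refine ⟨F.measurable_h μ p n, fun x => div_nonneg (hH.nonneg x) hprod.le,
    fun x hx => ?_, fun x => ?_⟩
  · rw [FKModel.h, le_div_iff₀ hprod, inv_mul_le_iff₀ (by positivity)]
    exact hup.trans (by gcongr; exact hH.le_of_mem x hx)
  · rw [FKModel.h, div_le_iff₀ hprod]
    have hv := expWeight_pos V x
    calc F.semigroupOp p n (fun _ => 1) x ≤ A * j * expWeight V x := hH.le_mul x
      _ = A * B * expWeight V x * (j / B) := by field_simp
      _ ≤ _ := by gcongr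

end FlowBound

lemma StabilityData.exists_uniformBounds [IsProbabilityMeasure μ] (hS : StabilityData V δ d₀ m)
    (hμ : Integrable (expWeight V) μ) (b : ℝ → ℝ) (R : ℝ → NNReal) :
    ∃ r B l D, d₀ ≤ r ∧ 0 < B ∧ 0 < l ∧ 0 < D ∧
      ∀ F, StabilityConditions F V δ d₀ b m R → UniformBounds F V μ r B l D := by
  obtain ⟨r, B, hr, hB, hflow⟩ := hS.exists_flowBound hμ b R
  obtain ⟨A, hA, hmass⟩ := hS.exists_weightBounds_semigroupOp_one hr b R
  refine ⟨r, B, (m r).real (sublevel V r) / B, A * B, hr, hB,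
    div_pos (hS.measureReal_pos hr le_rfl) hB, mul_pos hA hB,
    fun F hF => ⟨hflow F hF, (hflow F hF).le_lam hF hr hB, fun p n hpn => ?_⟩⟩
  obtain ⟨j, hj, hH⟩ := hmass F hF p n hpn
  exact (hflow F hF).weightBounds_h hS.measurable_V hS.nonneg_V hA hB hj hpn hH

variable {l D : ℝ}

lemma StabilityData.exists_integral_Q_le (hS : StabilityData V δ d₀ m) (hr : d₀ ≤ r) (hl : 0 < l)
    (hD : 0 < D) (b : ℝ → ℝ) (R : ℝ → NNReal) :
    ∃ K, 0 < K ∧ ∀ F, StabilityConditions F V δ d₀ b m R → ∀ H, WeightBounds V r D⁻¹ D H →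
      ∀ lam, l ≤ lam → ∀ n x, ∫ y, expWeight V y ∂(F.Q (n + 1) x) ≤
        lam * expWeight V x / 2 + K * ∫ y, H y ∂(F.Q (n + 1) x) := by
  obtain ⟨d, hrd, hδ⟩ := hS.exists_exp_neg_le (half_pos hl) r
  have hθ := hS.measureReal_pos hr hrd
  refine ⟨Real.exp (|b d| + d) / ((m d).real (sublevel V r) * D⁻¹), by positivity,
    fun F hF H hH lam hlam n x => ?_⟩
  have hv := expWeight_pos V x
  have hH0 : 0 ≤ ∫ y, H y ∂(F.Q (n + 1) x) := integral_nonneg hH.nonneg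
  by_cases hx : x ∈ sublevel V d
  · have hlow := hF.mul_le_integral_Q hH (hr.trans hrd) n hx
    have hlv : 0 ≤ lam * expWeight V x / 2 :=
      div_nonneg (mul_nonneg (hl.le.trans hlam) hv.le) zero_le_two
    refine ((hF.integral_Q_le_of_mem (hr.trans hrd) n hx).trans ?_).trans
      (le_add_of_nonneg_left hlv)
    rw [div_mul_eq_mul_div, le_div_iff₀ (by positivity)]
    gcongr
  · refine ((hF.integral_Q_le_of_notMem (hr.trans hrd) n hx).trans ?_).trans
      (le_add_of_nonneg_right (by positivity))
    calc Real.exp (-(δ * d)) * expWeight V x ≤ l / 2 * expWeight V x := by gcongr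
      _ ≤ lam / 2 * expWeight V x := by gcongr
      _ = lam * expWeight V x / 2 := by ring

lemma StabilityData.exists_mem_sublevel (hS : StabilityData V δ d₀ m) (r : ℝ) (hl : 0 < l)
    (hD : 0 < D) {κ : ℝ} (hκ : 0 < κ) (b : ℝ → ℝ) (R : ℝ → NNReal) :
    ∃ d, r ≤ d ∧ ∀ F, StabilityConditions F V δ d₀ b m R → ∀ H, WeightBounds V r D⁻¹ D H →
      ∀ lam, l ≤ lam → ∀ n x,
        lam * expWeight V x < κ * ∫ y, H y ∂(F.Q (n + 1) x) → x ∈ sublevel V d := by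
  set E := Real.exp |b d₀|
  have : 0 < E := Real.exp_pos _
  obtain ⟨d, hrd, hδ⟩ := hS.exists_exp_neg_le (show 0 < l / (κ * (D * E)) by positivity) r
  refine ⟨d, hrd, fun F hF H hH lam hlam n x hx => ?_⟩
  rw [Real.exp_neg, le_div_iff₀ (by positivity), inv_mul_le_iff₀ (Real.exp_pos _)] at hδ
  have hexp : l * Real.exp (V x) < l * Real.exp (δ * d + V x * (1 - δ)) :=
    calc l * Real.exp (V x) ≤ lam * expWeight V x := by unfold expWeight; gcongr
      _ < κ * ∫ y, H y ∂(F.Q (n + 1) x) := hx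
      _ ≤ κ * (D * ∫ y, expWeight V y ∂(F.Q (n + 1) x)) := by
        gcongr
        exact hH.integral_le (hF.integrable_Q n x)
      _ ≤ κ * (D * (E * Real.exp (V x * (1 - δ)))) := by
        gcongr
        exact hF.integral_Q_le_exp_mul le_rfl n x
      _ = κ * (D * E) * Real.exp (V x * (1 - δ)) := by ring
      _ ≤ Real.exp (δ * d) * l * Real.exp (V x * (1 - δ)) := by gcongr
      _ = l * Real.exp (δ * d + V x * (1 - δ)) := by rw [Real.exp_add]; ring
  have hVd := Real.exp_lt_exp.1 (lt_of_mul_lt_mul_left hexp hl.le)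
  exact (lt_of_mul_lt_mul_left (by linarith : δ * V x < δ * d) hS.delta_pos.le).le

lemma StabilityData.exists_mul_integral_Q_le (hS : StabilityData V δ d₀ m) (hr : d₀ ≤ r)
    (hrd : r ≤ d) (hD : 0 < D) (b : ℝ → ℝ) (R : ℝ → NNReal) :
    ∃ s, 0 < s ∧ ∀ F, StabilityConditions F V δ d₀ b m R → ∀ H, WeightBounds V r D⁻¹ D H →
      ∀ n, ∀ x ∈ sublevel V d, s * ∫ y, H y ∂(F.Q (n + 1) x) ≤ ∫ y, H y ∂(m d) := by
  have hd := hr.trans hrd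
  have hθ := hS.measureReal_pos hr hrd
  refine ⟨(m d).real (sublevel V r) * D⁻¹ / (D * Real.exp (|b d| + d)), by positivity,
    fun F hF H hH n x hx => ?_⟩
  refine le_trans ?_ (hF.mul_le_integral_minorant hH hd hx)
  rw [div_mul_eq_mul_div, div_le_iff₀ (by positivity)]
  gcongr
  exact (hH.integral_le (hF.integrable_Q n x)).trans
    (by gcongr; exact hF.integral_Q_le_of_mem hd n hx)

lemma StabilityConditions.integral_Q_pos (hF : StabilityConditions F V δ d₀ b m R) (hr : d₀ ≤ r)
    {c C : ℝ} (hc : 0 < c) {H : X → ℝ} (hH : WeightBounds V r c C H) (n : ℕ) (x : X) :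
    0 < ∫ y, H y ∂(F.Q (n + 1) x) :=
  (mul_pos (hF.measureReal_pos hr (le_max_left r (V x))) hc).trans_le
    (hF.mul_le_integral_Q hH (le_max_of_le_left hr) n (le_max_right r (V x)))

lemma StabilityData.exists_driftMinorization (hS : StabilityData V δ d₀ m) (hr : d₀ ≤ r)
    (hl : 0 < l) (hD : 0 < D) (b : ℝ → ℝ) (R : ℝ → NNReal) :
    ∃ d K β, 0 < K ∧ 0 < β ∧ ∀ F, StabilityConditions F V δ d₀ b m R →
      ∀ H, WeightBounds V r D⁻¹ D H → ∀ lam, l ≤ lam → ∀ n,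
        DriftMinorization (F.Q (n + 1)) (m d) (expWeight V) H (fun x => lam * expWeight V x)
          K β := by
  obtain ⟨K, hK, hdrift⟩ := hS.exists_integral_Q_le hr hl hD b R
  obtain ⟨d, hrd, hmem⟩ := hS.exists_mem_sublevel r hl hD (κ := 16 * K) (by positivity) b R
  obtain ⟨s, hs, hoverlap⟩ := hS.exists_mul_integral_Q_le hr hrd hD b R
  refine ⟨d, K, s / (2 * K), hK, by positivity, fun F hF H hH lam hlam n =>
    { integrable_weight := hF.integrable_Q n
      integrable := fun x => hH.integrable (hF.integrable_Q n x)
      weight_nonneg := fun x => (expWeight_pos V x).le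
      index_weight_nonneg := fun x => mul_nonneg (hl.le.trans hlam) (expWeight_pos V x).le
      integral_pos := hF.integral_Q_pos hr (inv_pos.2 hD) hH n
      drift := hdrift F hF H hH lam hlam n
      minorization := fun x hx => ?_ }⟩
  have hxd := hmem F hF H hH lam hlam n x hx
  have hβK : 2 * (s / (2 * K) * K) = s := by field_simp
  exact ⟨hF.le_Q d (hr.trans hrd) n x hxd, by rw [hβK]; exact hoverlap F hF H hH n x hxd⟩

lemma StabilityData.exists_contraction_Q (hS : StabilityData V δ d₀ m) (hr : d₀ ≤ r)
    (hl : 0 < l) (hD : 0 < D) (b : ℝ → ℝ) (R : ℝ → NNReal) :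
    ∃ β ρ, 0 < β ∧ 0 ≤ ρ ∧ ρ < 1 ∧ ∀ F, StabilityConditions F V δ d₀ b m R →
      ∀ H, WeightBounds V r D⁻¹ D H → ∀ lam, l ≤ lam → ∀ n f,
        (∀ x, Integrable f (F.Q (n + 1) x)) → ∀ a c, 0 ≤ a →
        (∀ x, |f x - c * H x| ≤ a * (H x + β * expWeight V x)) →
        ∃ c', ∀ x, |∫ y, f y ∂(F.Q (n + 1) x) - c' * ∫ y, H y ∂(F.Q (n + 1) x)| ≤
          ρ * a * (∫ y, H y ∂(F.Q (n + 1) x) + β * (lam * expWeight V x)) := by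
  obtain ⟨d, K, β, hK, hβ, hq⟩ := hS.exists_driftMinorization hr hl hD b R
  refine ⟨β, max (3 / 4) (1 - β * K), hβ, le_max_of_le_left (by norm_num),
    max_lt (by norm_num) (sub_lt_self _ (mul_pos hβ hK)),
    fun F hF H hH lam hlam n f hf a c ha hfc => ?_⟩
  exact (hq F hF H hH lam hlam n).exists_abs_integral_sub_mul_le hβ.le hf
    (le_max_left _ _) (le_max_right _ _) ha hfc

variable {φ : X → ℝ} {B : ℝ}

lemma StabilityData.exists_contraction_normOp (hS : StabilityData V δ d₀ m) (hr : d₀ ≤ r)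
    (hl : 0 < l) (hD : 0 < D) (b : ℝ → ℝ) (R : ℝ → NNReal) (μ : Measure X) :
    ∃ β ρ, 0 < β ∧ 0 ≤ ρ ∧ ρ < 1 ∧ ∀ F B, StabilityConditions F V δ d₀ b m R →
      UniformBounds F V μ r B l D → ∀ φ, MemLv (expWeight V) φ → ∀ p n, p ≤ n →
        ∃ c, ∀ x, |F.normOp μ p n φ x - c * F.h μ p n x| ≤
          ρ ^ (n - p) * (vNorm (expWeight V) φ / β) * (F.h μ p n x + β * expWeight V x) := by
  obtain ⟨β, ρ, hβ, hρ, hρ1, hstep⟩ := hS.exists_contraction_Q hr hl hD b R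
  refine ⟨β, ρ, hβ, hρ, hρ1, fun F B hF hU φ hφ p n hpn => ?_⟩
  have hN := vNorm_nonneg (expWeight_pos V) φ
  induction hpn using Nat.decreasingInduction with
  | self =>
    refine ⟨0, fun x => ?_⟩
    have hh : 0 ≤ vNorm (expWeight V) φ / β * F.h μ n n x :=
      mul_nonneg (by positivity) ((hU.weightBounds n n le_rfl).nonneg x)
    rw [F.normOp_self n hφ.1, Nat.sub_self, pow_zero, one_mul, zero_mul, sub_zero, mul_add,
      ← mul_assoc, div_mul_cancel₀ _ hβ.ne']
    exact (hφ.abs_le (expWeight_pos V) x).trans (le_add_of_nonneg_left hh)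
  | of_succ p hpn ih =>
    obtain ⟨c, hc⟩ := ih
    have hlam : 0 < F.lam μ p := hl.trans_le (hU.le_lam p)
    have hφi : ∀ x, Integrable φ (F.semigroup p n x) := fun x =>
      hφ.integrable (expWeight_pos V) (hF.integrable_semigroup hpn.le x)
    obtain ⟨c', hc'⟩ := hstep F hF _ (hU.weightBounds (p + 1) n hpn) _ (hU.le_lam p) p
      (F.normOp μ (p + 1) n φ) (fun x => F.integrable_normOp_Q hpn (hφi x)) _ c
      (by positivity) hc
    refine ⟨c', fun x => le_of_mul_le_mul_left ?_ hlam⟩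
    have := hF.isFiniteMeasure_semigroup hpn.le x
    have hx := hc' x
    rw [F.integral_normOp_Q hpn hlam.ne' (hφi x), F.integral_h_Q hpn hlam.ne'] at hx
    rw [← abs_of_pos hlam, ← abs_mul, abs_of_pos hlam, show n - p = n - (p + 1) + 1 by lia,
      pow_succ, mul_sub, mul_left_comm _ c']
    exact hx.trans_eq (by ring)

namespace FlowBound

variable {C β D c : ℝ} (h : FlowBound F V μ r B)
include h

lemma integral_eta_le (hV : ∀ x, 0 ≤ V x) (hB : 0 ≤ B) (n : ℕ) :
    ∫ y, expWeight V y ∂(F.eta μ n) ≤ B := by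
  have := h.isFiniteMeasure hV n
  have := h.neZero n
  rw [F.integral_eta, div_le_iff₀ measureReal_univ_pos]
  exact (h.integral_le n).trans
    (mul_le_mul_of_nonneg_left (measureReal_mono (Set.subset_univ _)) hB)

lemma abs_integral_eta_sub_le (hV : ∀ x, 0 ≤ V x) (hB : 0 ≤ B) (hβ : 0 ≤ β) (hC : 0 ≤ C)
    (hpn : p ≤ n) (hφ : Integrable φ (F.gamma μ n))
    (hc : ∀ x, |F.normOp μ p n φ x - c * F.h μ p n x| ≤
      C * (F.h μ p n x + β * expWeight V x)) :
    |(∫ y, φ y ∂(F.eta μ n)) - c| ≤ C * (1 + β * B) := by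
  have := h.isFiniteMeasure hV
  have := h.neZero
  have hγ := NeZero.ne (F.gamma μ p)
  have hφi := F.integrable_normOp_eta hγ hpn hφ
  have hhi : Integrable (F.h μ p n) (F.eta μ p) :=
    F.integrable_normOp_eta hγ hpn (integrable_const 1)
  have hvi := F.integrable_eta hγ (h.integrable p)
  calc |(∫ y, φ y ∂(F.eta μ n)) - c|
      = ‖∫ y, (F.normOp μ p n φ y - c * F.h μ p n y) ∂(F.eta μ p)‖ := by
        rw [integral_sub hφi (hhi.const_mul c), integral_const_mul, F.integral_normOp_eta hpn hφ,
          F.integral_h_eta hpn, mul_one, Real.norm_eq_abs]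
    _ ≤ ∫ y, C * (F.h μ p n y + β * expWeight V y) ∂(F.eta μ p) :=
        norm_integral_le_of_norm_le ((hhi.add (hvi.const_mul β)).const_mul C) (.of_forall hc)
    _ = C * (1 + β * ∫ y, expWeight V y ∂(F.eta μ p)) := by
        rw [integral_const_mul, integral_add hhi (hvi.const_mul β), integral_const_mul,
          F.integral_h_eta hpn]
    _ ≤ C * (1 + β * B) := by
        gcongr
        exact h.integral_eta_le hV hB p

lemma abs_normOp_sub_le (hV : ∀ x, 0 ≤ V x) (hB : 0 ≤ B) (hβ : 0 ≤ β) (hC : 0 ≤ C)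
    (hpn : p ≤ n) (hh : WeightBounds V r D⁻¹ D (F.h μ p n)) (hφ : Integrable φ (F.gamma μ n))
    (hc : ∀ x, |F.normOp μ p n φ x - c * F.h μ p n x| ≤
      C * (F.h μ p n x + β * expWeight V x)) (x : X) :
    |F.normOp μ p n φ x - F.h μ p n x * ∫ y, φ y ∂(F.eta μ n)| ≤
      C * (D * (2 + β * B) + β) * expWeight V x := by
  have hh0 := hh.nonneg x
  calc |F.normOp μ p n φ x - F.h μ p n x * ∫ y, φ y ∂(F.eta μ n)|
      = |(F.normOp μ p n φ x - c * F.h μ p n x) -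
          F.h μ p n x * ((∫ y, φ y ∂(F.eta μ n)) - c)| := by congr 1; ring
    _ ≤ |F.normOp μ p n φ x - c * F.h μ p n x| +
          F.h μ p n x * |(∫ y, φ y ∂(F.eta μ n)) - c| := by
        refine (abs_sub _ _).trans_eq ?_
        rw [abs_mul, abs_of_nonneg hh0]
    _ ≤ C * (F.h μ p n x + β * expWeight V x) + F.h μ p n x * (C * (1 + β * B)) :=
        add_le_add (hc x) (mul_le_mul_of_nonneg_left
          (h.abs_integral_eta_sub_le hV hB hβ hC hpn hφ hc) hh0)
    _ = C * (F.h μ p n x * (2 + β * B) + β * expWeight V x) := by ring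
    _ ≤ C * (D * expWeight V x * (2 + β * B) + β * expWeight V x) := by
        gcongr
        exact hh.le_mul x
    _ = C * (D * (2 + β * B) + β) * expWeight V x := by ring

end FlowBound

lemma StabilityData.exists_abs_normOp_sub_le [IsProbabilityMeasure μ]
    (hS : StabilityData V δ d₀ m) (hμ : Integrable (expWeight V) μ) (b : ℝ → ℝ)
    (R : ℝ → NNReal) :
    ∃ ρ c, 0 ≤ ρ ∧ ρ < 1 ∧ 0 ≤ c ∧ ∀ F, StabilityConditions F V δ d₀ b m R →
      (∀ n, 0 < F.lam μ n) ∧ ∀ φ, MemLv (expWeight V) φ → ∀ n p, p ≤ n → ∀ x,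
        Integrable φ (F.semigroup p n x) ∧ Integrable φ (F.eta μ n) ∧
        |F.normOp μ p n φ x - F.h μ p n x * ∫ y, φ y ∂(F.eta μ n)| ≤
          ρ ^ (n - p) * vNorm (expWeight V) φ * c * expWeight V x := by
  obtain ⟨r, B, l, D, hr, hB, hl, hD, hU⟩ := hS.exists_uniformBounds hμ b R
  obtain ⟨β, ρ, hβ, hρ, hρ1, hcontr⟩ := hS.exists_contraction_normOp hr hl hD b R μ
  refine ⟨ρ, (D * (2 + β * B) + β) / β, hρ, hρ1, by positivity,
    fun F hF => ⟨fun n => hl.trans_le ((hU F hF).le_lam n), fun φ hφ n p hpn x => ?_⟩⟩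
  have hF' := hU F hF
  have hN := vNorm_nonneg (expWeight_pos V) φ
  have := hF'.neZero n
  have hφn := hφ.integrable (expWeight_pos V) (hF'.integrable n)
  obtain ⟨c, hc⟩ := hcontr F B hF hF' φ hφ p n hpn
  refine ⟨hφ.integrable (expWeight_pos V) (hF.integrable_semigroup hpn x),
    F.integrable_eta (NeZero.ne _) hφn, ?_⟩
  refine (hF'.abs_normOp_sub_le hF.nonneg_V hB.le hβ.le (by positivity) hpn
    (hF'.weightBounds p n hpn) hφn hc x).trans_eq ?_
  ring

end Stability

lemma DriftCondition.stabilityConditions {X : Type*} [MeasurableSpace X] {F : FKModel X}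
    {V : X → ℝ} {δ d₀ : ℝ} {b εm εp : ℝ → ℝ} {ν : ℝ → Measure X}
    (hD : DriftCondition F V δ d₀ b) (hm : MinorizationCondition F V d₀ εm ν)
    (hM : MajorizationCondition F V d₀ εm ν εp) :
    StabilityConditions F V δ d₀ b
      (fun d => ENNReal.ofReal (εm d) • (ν d).restrict (sublevel V d))
      (fun d => (εp d / εm d).toNNReal) where
  measurable_V := hD.measurable_V
  nonneg_V x := zero_le_one.trans (hD.one_le_V x)
  delta_pos := hD.delta_pos
  isFiniteMeasure d hd := by
    have := (hm.nu_mem d hd).1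
    exact Measure.smul_finite _ ENNReal.ofReal_ne_top
  measure_pos r d hr hrd := by
    have hsub : sublevel V r ⊆ sublevel V d := fun x hx => le_trans hx hrd
    rw [Measure.smul_apply, Measure.restrict_eq_self _ hsub, smul_eq_mul]
    exact ENNReal.mul_pos (ENNReal.ofReal_pos.2 (hm.eps_pos d (hr.trans hrd))).ne'
      (hm.nu_pos d (hr.trans hrd) r ⟨hr, hrd⟩).ne'
  lintegral_Q_le d hd n := hD.drift d hd (n + 1) n.succ_pos
  le_Q d hd n x hx := by
    refine Measure.le_iff.2 fun A hA => ?_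
    rw [Measure.smul_apply, smul_eq_mul, Measure.restrict_apply hA, Set.inter_comm]
    exact (hm.minor d hd (n + 1) n.succ_pos x hx A hA).trans (measure_mono Set.inter_subset_right)
  restrict_Q_le d hd n x hx := by
    refine Measure.le_iff.2 fun A hA => ?_
    have hε := hm.eps_pos d hd
    have hmul : ENNReal.ofReal (εp d / εm d) * ENNReal.ofReal (εm d) = ENNReal.ofReal (εp d) := by
      rw [← ENNReal.ofReal_mul (div_nonneg (hε.le.trans (hM.eps_le d hd)) hε.le),
        div_mul_cancel₀ _ hε.ne']
    rw [Measure.smul_apply, Measure.smul_apply, Measure.restrict_apply hA,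
      Measure.restrict_apply hA, Set.inter_comm, ENNReal.smul_def, smul_eq_mul, smul_eq_mul,
      ← mul_assoc, ← ENNReal.ofReal, hmul]
    exact hM.major d hd (n + 1) n.succ_pos x hx A hA

theorem theorem3_general {X : Type*} [MeasurableSpace X] (V : X → ℝ) (δ d₀ : ℝ) (b : ℝ → ℝ)
    (m : ℝ → Measure X) (R : ℝ → NNReal) (μ : Measure X) :
    ∃ ρ c : ℝ, 0 ≤ ρ ∧ ρ < 1 ∧
      ∀ F : FKModel X, StabilityConditions F V δ d₀ b m R → MemPv (expWeight V) μ →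
        (∀ n, 0 < F.lam μ n) ∧
        ∀ φ : X → ℝ, MemLv (expWeight V) φ → ∀ n p : ℕ, p ≤ n → ∀ x : X,
          Integrable φ (F.semigroup p n x) ∧ Integrable φ (F.eta μ n) ∧
          |F.semigroupOp p n φ x / (∏ q ∈ Finset.Ico p n, F.lam μ q)
              - F.h μ p n x * ∫ y, φ y ∂(F.eta μ n)|
            ≤ ρ ^ (n - p) * vNorm (expWeight V) φ * c * expWeight V x
                * ∫ y, expWeight V y ∂μ := by
  by_cases hdata : StabilityData V δ d₀ m ∧ MemPv (expWeight V) μ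
  swap
  · exact ⟨0, 0, le_rfl, one_pos, fun F hF hμ => absurd ⟨hF.toStabilityData, hμ⟩ hdata⟩
  obtain ⟨hS, hprob, hfin⟩ := hdata
  have hμ := (integrable_expWeight_iff hS.measurable_V).2 hfin.ne
  obtain ⟨ρ, c, hρ, hρ1, hc, hbound⟩ := hS.exists_abs_normOp_sub_le hμ b R
  refine ⟨ρ, c, hρ, hρ1, fun F hF _ => ⟨(hbound F hF).1, fun φ hφ n p hpn x => ?_⟩⟩
  obtain ⟨hφp, hφn, hle⟩ := (hbound F hF).2 φ hφ n p hpn x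
  refine ⟨hφp, hφn, hle.trans (le_mul_of_one_le_right ?_ ?_)⟩
  · have := vNorm_nonneg (expWeight_pos V) φ
    have := expWeight_pos V x
    positivity
  · simpa using measureReal_univ_le_integral_expWeight hS.nonneg_V hμ

theorem theorem3 {X : Type*} [TopologicalSpace X] [PolishSpace X] [NoncompactSpace X]
    [MeasurableSpace X] [BorelSpace X]
    (V : X → ℝ) (δ d₀ : ℝ) (b εm εp : ℝ → ℝ) (ν : ℝ → Measure X) (μ : Measure X) :
    ∃ ρ c : ℝ, 0 ≤ ρ ∧ ρ < 1 ∧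
      ∀ F : FKModel X,
        DriftCondition F V δ d₀ b →
        MemPv (expWeight V) μ →
        MinorizationCondition F V d₀ εm ν →
        MajorizationCondition F V d₀ εm ν εp →
        (∀ n, 0 < F.lam μ n) ∧
        ∀ φ : X → ℝ, MemLv (expWeight V) φ → ∀ n p : ℕ, 1 ≤ n → p < n → ∀ x : X,
          Integrable φ (F.semigroup p n x) ∧ Integrable φ (F.eta μ n) ∧
          |F.semigroupOp p n φ x / (∏ q ∈ Finset.Ico p n, F.lam μ q)
              - F.h μ p n x * ∫ y, φ y ∂(F.eta μ n)|
            ≤ ρ ^ (n - p) * vNorm (expWeight V) φ * c * expWeight V x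
                * ∫ y, expWeight V y ∂μ := by
  obtain ⟨ρ, c, hρ, hρ1, hbound⟩ := theorem3_general V δ d₀ b
    (fun d => ENNReal.ofReal (εm d) • (ν d).restrict (sublevel V d))
    (fun d => (εp d / εm d).toNNReal) μ
  exact ⟨ρ, c, hρ, hρ1, fun F hD hμ hm hM => (hbound F (hD.stabilityConditions hm hM) hμ).imp_right
    fun h φ hφ n p _ hpn => h φ hφ n p hpn.le⟩
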